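/- **Setting.** Let $\Omega\subset\mathbb R^2$ be open, bounded and convex, and let $\partial\Omega$ be a closed $C^2$ curve, i.e. the image of a regular, simple, closed $C^2$ parametrization; let $\mathbf n$ be its outward unit normal. For $\delta>0$, with $B_\delta(x)$ the open disc of radius $\delta$ about $x$, put $$\Omega^-=\{x\in\Omega: B_\delta(x)\subset\Omega\},\quad \Omega_\gamma^-=\Omega\setminus\overline{\Omega^-},\quad \Omega^+=\mathbb R^2\setminus\overline{\{x: B_\delta(x)\cap\Omega=\emptyset\}},\quad \Omega_\gamma^+=\Omega^+\setminus\overline\Omega .$$ A kernel with horizon $\delta$ and second moment $\sigma$ is $\gamma_\delta(x,y)=\widetilde\gamma_\delta(|x-y|)$, where $\widetilde\gamma_\delta\ge 0$, $\widetilde\gamma_\delta\in L^1(0,\delta)$, $\widetilde\gamma_\delta(r)=0$ for $r>\delta$, and $\frac{\pi}{2}\int_0^\delta r^3\,\widetilde\gamma_\delta(r)\,dr=\sigma$, with $\sigma$ independent of $\delta$. The three nonlocal Neumann operators are $$\mathcal N_\Omega^-u(x)=-\int_{\Omega_\gamma^+}[u(x)-u(y)]\gamma_\delta(x,y)\,dy\quad(x\in\Omega_\gamma^-),$$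 $$\mathcal N_\Omega^+u(x)=\int_{\Omega_\gamma^-}[u(x)-u(y)]\gamma_\delta(x,y)\,dy,\qquad \mathcal N_\Omega^*u(x)=\int_{\Omega^+}[u(x)-u(y)]\gamma_\delta(x,y)\,dy\quad(x\in\Omega_\gamma^+).$$ For each of them write $u\in S_N(\Omega)$ if $\mathcal N_\Omega u$ is bounded on the layer on which it is defined ($\Omega_\gamma^-$ for $\mathcal N_\Omega^-$, $\Omega_\gamma^+$ for $\mathcal N_\Omega^+$ and $\mathcal N_\Omega^*$). **Theorem.** Fix $\sigma$ and $\delta_0>0$, and let $u$ be of class $C^2$ and $v$ of class $C^1$ on the interaction layer $\Omega_\gamma^-\cup\partial\Omega\cup\Omega_\gamma^+$ of width $\delta_0$ (a neighbourhood of $\partial\Omega$, so that both are regular across $\partial\Omega$). Then the boundary integral $\langle\sigma\partial_{\mathbf n}u,v\rangle_{\partial\Omega}=\int_{\partial\Omega}\sigma\,\partial_{\mathbf n}u\,v\,ds$ converges absolutely, and there are constants $C$ and $\delta_1>0$ such that for all $0<\delta<\delta_1$, every kernel with horizon $\delta$ and second moment $\sigma$, and each of the three operators for which $u\in S_N(\Omega)$,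 the integral defining the operator on its layer and the pairing below converge absolutely, and $$\bigl|(\mathcal N_\Omega^-u,v)_{\Omega_\gamma^-}-\langle\sigma\partial_{\mathbf n}u,v\rangle_{\partial\Omega}\bigr|\le C\delta,\quad \bigl|(\mathcal N_\Omega^+u,v)_{\Omega_\gamma^+}-\langle\sigma\partial_{\mathbf n}u,v\rangle_{\partial\Omega}\bigr|\le C\delta,\quad \bigl|(\mathcal N_\Omega^*u,v)_{\Omega_\gamma^+}-\langle\sigma\partial_{\mathbf n}u,v\rangle_{\partial\Omega}\bigr|\le C\delta,$$ where $(f,g)_D=\int_D fg\,dx$. -/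

import Mathlib

open MeasureTheory Set

noncomputable section

namespace NonlocalNeumann

/-- The Euclidean plane `ℝ²`. -/
abbrev Plane : Type := EuclideanSpace ℝ (Fin 2)

/-! ### Interaction layers -/

/-- `Ω⁻ = {x ∈ Ω : B_δ(x) ⊆ Ω}`. -/
def innerCore (Ω : Set Plane) (δ : ℝ) : Set Plane :=
  {x | x ∈ Ω ∧ Metric.ball x δ ⊆ Ω}

/-- The inner interaction layer `Ω_γ⁻ = Ω \ closure Ω⁻`. -/
def innerLayer (Ω : Set Plane) (δ : ℝ) : Set Plane :=
  Ω \ closure (innerCore Ω δ)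

/-- `Ω⁺ = ℝ² \ closure {x : B_δ(x) ∩ Ω = ∅}`. -/
def outerDomain (Ω : Set Plane) (δ : ℝ) : Set Plane :=
  (closure {x | Metric.ball x δ ∩ Ω = ∅})ᶜ

/-- The outer interaction layer `Ω_γ⁺ = Ω⁺ \ closure Ω`. -/
def outerLayer (Ω : Set Plane) (δ : ℝ) : Set Plane :=
  outerDomain Ω δ \ closure Ω

/-- The whole interaction layer across the boundary: `Ω_γ⁻`, `Ω_γ⁺` and the curve `∂Ω`
between them. -/
def fullLayer (Ω : Set Plane) (δ : ℝ) : Set Plane :=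
  innerLayer Ω δ ∪ frontier Ω ∪ outerLayer Ω δ

/-! ### Kernels -/

/-- `g` is the radial profile of a nonlocal kernel `γ_δ(x, y) = g |x - y|` with horizon `δ`
and second moment `½ ∫ x ⊗ x γ_δ(|x|) dx = σ I`, that is `σ = (π / 2) ∫₀^δ r³ g(r) dr`. -/
structure IsKernel (δ σ : ℝ) (g : ℝ → ℝ) : Prop where
  horizon_pos : 0 < δ
  integrable : IntegrableOn g (Ioo 0 δ)
  nonneg : ∀ r, 0 ≤ r → 0 ≤ g r
  eq_zero_of_lt : ∀ r, δ < r → g r = 0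
  second_moment : Real.pi / 2 * ∫ r in (0 : ℝ)..δ, r ^ 3 * g r = σ

/-- The integrand `[u(x) - u(y)] γ_δ(x, y)`. -/
def jump (g : ℝ → ℝ) (u : Plane → ℝ) (x y : Plane) : ℝ :=
  (u x - u y) * g ‖x - y‖

/-! ### The three nonlocal Neumann operators -/

/-- The inner operator `N⁻`, acting on points `x ∈ Ω_γ⁻`. -/
def neumannInner (Ω : Set Plane) (δ : ℝ) (g : ℝ → ℝ) (u : Plane → ℝ) (x : Plane) : ℝ :=
  -∫ y in outerLayer Ω δ, jump g u x y

/-- The outer operator `N⁺`, acting on points `x ∈ Ω_γ⁺`. -/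
def neumannOuter (Ω : Set Plane) (δ : ℝ) (g : ℝ → ℝ) (u : Plane → ℝ) (x : Plane) : ℝ :=
  ∫ y in innerLayer Ω δ, jump g u x y

/-- The outer operator `N*`, acting on points `x ∈ Ω_γ⁺`. -/
def neumannStar (Ω : Set Plane) (δ : ℝ) (g : ℝ → ℝ) (u : Plane → ℝ) (x : Plane) : ℝ :=
  ∫ y in outerDomain Ω δ, jump g u x y

/-- The condition defining the spaces `S_N`: `N u` (here `w`) is bounded on the layer `D` on
which the operator `N` acts. -/
def BoundedOnLayer (w : Plane → ℝ) (D : Set Plane) : Prop :=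
  ∃ M : ℝ, ∀ x ∈ D, |w x| ≤ M

/-! ### The boundary curve -/

/-- `Γ` is a regular, simple, closed `C²` parametrization, with period `L`, of the set `S`. -/
structure IsClosedC2Curve (Γ : ℝ → Plane) (L : ℝ) (S : Set Plane) : Prop where
  period_pos : 0 < L
  contDiff : ContDiff ℝ 2 Γ
  periodic : Function.Periodic Γ L
  regular : ∀ η, deriv Γ η ≠ 0
  injOn : InjOn Γ (Ico 0 L)
  range_eq : range Γ = S

/-- A unit vector orthogonal to the curve at `Γ η` (the unit tangent turned by a right angle). -/
def curveNormal (Γ : ℝ → Plane) (η : ℝ) : Plane :=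
  ‖deriv Γ η‖⁻¹ • !₂[deriv Γ η 1, -(deriv Γ η 0)]

open Classical in
/-- The outward unit normal at `Γ η` of a convex set `Ω` bounded by `Γ`: of the two unit vectors
`ν` orthogonal to the curve, the one for which `Ω` lies in the half plane `⟪x - Γ η, ν⟫ ≤ 0`. -/
def outwardNormal (Ω : Set Plane) (Γ : ℝ → Plane) (η : ℝ) : Plane :=
  if ∀ x ∈ Ω, inner ℝ (x - Γ η) (curveNormal Γ η) ≤ 0 then curveNormal Γ η
  else -curveNormal Γ η

/-- The integrand, in the parameter `η`, of the boundary pairing `⟨σ ∂ₙu, v⟩` with respect to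
arc length. -/
def boundaryDensity (Ω : Set Plane) (Γ : ℝ → Plane) (σ : ℝ) (u v : Plane → ℝ) (η : ℝ) : ℝ :=
  σ * fderiv ℝ u (Γ η) (outwardNormal Ω Γ η) * v (Γ η) * ‖deriv Γ η‖

/-- The boundary pairing `⟨σ ∂ₙu, v⟩_{∂Ω}`. -/
def boundaryPairing (Ω : Set Plane) (Γ : ℝ → Plane) (L σ : ℝ) (u v : Plane → ℝ) : ℝ :=
  ∫ η in (0 : ℝ)..L, boundaryDensity Ω Γ σ u v η

end NonlocalNeumann

end

noncomputable section

namespace NonlocalNeumann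

/-! ### Geometry of the layers -/

/-! Cut `u` and `v` off to compactly supported `w` and `φ` that agree with them near `∂Ω`. Only
pairs `x ∈ Ω`, `y ∉ Ω` with `|x - y| < δ` interact across the boundary, so the pairings of `N⁻` and
`N⁺` are the integrals of `(w y - w x) φ γ` over `Ω × Ωᶜ`, with `φ` taken at `x` and at `y`
respectively (`inner_pairing`, `outer_pairing`).

Put `y = x + z`. For fixed `z` the point `x` runs over `exitSet Ω z`, whose area is `O(|z|)` by
convexity. With `Ψ x = φ x • Dw x`, Taylor expansion replaces the integrand by `Ψ x z` up to
`O(|z|²)`. The kernel is even in `z`, so the contributions of `z` and `-z` may be added. Up to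
`O(|z|³)` their sum is `∫_Ω ψ(x) - ψ(x - z) dx` with `ψ = Ψ · z`, because the points that stay in
`Ω` cancel. By the divergence theorem this is the boundary integral of `Ψ(z) ⟪z, n⟫`, again up to
`O(|z|³)` (`abs_exit_add_exit_sub_boundary_le`). No tubular coordinates enter.

Integrating against the kernel, isotropy of the second moments turns the quadratic form in `z` into
`2σ ∫ Ψ(n)`, twice the boundary pairing. Since `|z| < δ` on the support, the cubic error costs
`O(δ)` times the second moment (`exists_abs_setIntegral_sub_boundary_le`).

For `N*` there is one further term, the interaction of the outer layer with itself. Antisymmetry of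
`w x - w y` makes its integrand quadratic in `|x - y|`, and the layer has area `O(δ)`, so it is
`O(δ)` as well. -/

theorem exists_mem_segment_frontier {Ω : Set Plane} {x y : Plane} (hx : x ∈ Ω) (hy : y ∉ Ω) :
    ∃ q ∈ segment ℝ x y, q ∈ frontier Ω := by
  by_contra! hcon
  have hx' : x ∈ interior Ω := by
    by_contra h
    exact hcon x (left_mem_segment ℝ x y) ⟨subset_closure hx, h⟩
  have hy' : y ∈ (closure Ω)ᶜ := fun h =>
    hcon y (right_mem_segment ℝ x y) ⟨h, fun h' => hy (interior_subset h')⟩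
  obtain ⟨q, -, h1, h2⟩ := (convex_segment (𝕜 := ℝ) x y).isPreconnected _ _ isOpen_interior
    isClosed_closure.isOpen_compl
    (fun q hq => or_iff_not_imp_right.2 fun h => by
      by_contra h'
      exact hcon q hq ⟨not_notMem.1 h, h'⟩)
    ⟨x, left_mem_segment ℝ x y, hx'⟩ ⟨y, right_mem_segment ℝ x y, hy'⟩
  exact h2 (interior_subset_closure h1)

theorem exists_frontier_dist_le {Ω : Set Plane} {x y : Plane} (hx : x ∈ Ω) (hy : y ∉ Ω) :
    ∃ q ∈ frontier Ω, dist x q ≤ dist x y ∧ dist y q ≤ dist x y := by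
  obtain ⟨q, hq, hqf⟩ := exists_mem_segment_frontier hx hy
  have h := dist_add_dist_of_mem_segment hq
  exact ⟨q, hqf, by linarith [dist_nonneg (x := q) (y := y)],
    by rw [dist_comm y q]; linarith [dist_nonneg (x := x) (y := q)]⟩

/-- Closing up the core adds no point of `Ω` with a complement point `y` at distance less than `δ`:
a core point near enough to `x` would contain `y` in its own disc. -/
theorem mem_innerLayer_iff {Ω : Set Plane} {δ : ℝ} {x : Plane} :
    x ∈ innerLayer Ω δ ↔ x ∈ Ω ∧ ∃ y, y ∉ Ω ∧ dist x y < δ := by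
  refine ⟨fun h => ⟨h.1, ?_⟩, fun ⟨hx, y, hy, hxy⟩ => ⟨hx, fun hc => ?_⟩⟩
  · by_contra! hcon
    refine h.2 (subset_closure ⟨h.1, fun y hy => ?_⟩)
    by_contra hyΩ
    rw [Metric.mem_ball, dist_comm] at hy
    exact absurd (hcon y hyΩ) (not_le.2 hy)
  · obtain ⟨w, hw, hxw⟩ := Metric.mem_closure_iff.1 hc (δ - dist x y) (by linarith)
    refine hy (hw.2 ?_)
    rw [Metric.mem_ball]
    have := dist_triangle y x w
    rw [dist_comm y x] at this
    linarith

theorem outerDomain_eq_thickening (Ω : Set Plane) (δ : ℝ) :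
    outerDomain Ω δ = Metric.thickening δ Ω := by
  have h : {x | Metric.ball x δ ∩ Ω = ∅} = (Metric.thickening δ Ω)ᶜ := by
    ext x
    simp only [mem_compl_iff, Metric.mem_thickening_iff, not_exists, not_and, not_lt]
    refine ⟨fun hx z hz => ?_, fun hx => ?_⟩
    · by_contra! hlt
      have : z ∈ Metric.ball x δ ∩ Ω := ⟨by rwa [Metric.mem_ball, dist_comm], hz⟩
      rw [hx] at this
      exact this
    · refine eq_empty_of_forall_notMem fun z hz => ?_
      have := hx z hz.2
      have h2 := hz.1
      rw [Metric.mem_ball, dist_comm] at h2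
      linarith
  rw [outerDomain, h, Metric.isOpen_thickening.isClosed_compl.closure_eq, compl_compl]

theorem mem_outerLayer_iff {Ω : Set Plane} {δ : ℝ} {x : Plane} :
    x ∈ outerLayer Ω δ ↔ x ∉ closure Ω ∧ ∃ y ∈ Ω, dist x y < δ := by
  rw [outerLayer, outerDomain_eq_thickening, mem_sdiff, Metric.mem_thickening_iff, and_comm]

/-- This makes the layer an open neighbourhood of the curve, as the cutting off and the derivatives
on `∂Ω` require. -/
theorem fullLayer_eq_thickening {Ω : Set Plane} (hΩ : IsOpen Ω) {δ : ℝ} (hδ : 0 < δ) :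
    fullLayer Ω δ = Metric.thickening δ (frontier Ω) := by
  ext x
  rw [fullLayer, mem_union, mem_union, mem_innerLayer_iff, mem_outerLayer_iff,
    Metric.mem_thickening_iff]
  constructor
  · rintro ((⟨hx, y, hy, hxy⟩ | hx) | ⟨hx, y, hy, hxy⟩)
    · obtain ⟨q, hq, h1, -⟩ := exists_frontier_dist_le hx hy
      exact ⟨q, hq, by linarith⟩
    · exact ⟨x, hx, by simpa using hδ⟩
    · obtain ⟨q, hq, -, h1⟩ := exists_frontier_dist_le hy (fun h => hx (subset_closure h))
      exact ⟨q, hq, by rw [dist_comm y x] at h1; linarith⟩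
  · rintro ⟨q, hq, hxq⟩
    by_cases hx : x ∈ Ω
    · refine Or.inl (Or.inl ⟨hx, q, fun h => ?_, hxq⟩)
      rw [hΩ.frontier_eq] at hq
      exact hq.2 h
    by_cases hx' : x ∈ closure Ω
    · exact Or.inl (Or.inr (by rw [hΩ.frontier_eq]; exact ⟨hx', hx⟩))
    · refine Or.inr ⟨hx', ?_⟩
      obtain ⟨w, hw, hqw⟩ := Metric.mem_closure_iff.1 (frontier_subset_closure hq)
        (δ - dist x q) (by linarith)
      exact ⟨w, hw, by linarith [dist_triangle x q w]⟩

theorem measurableSet_innerLayer {Ω : Set Plane} (hΩ : IsOpen Ω) (δ : ℝ) :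
    MeasurableSet (innerLayer Ω δ) :=
  hΩ.measurableSet.diff isClosed_closure.measurableSet

theorem measurableSet_outerLayer (Ω : Set Plane) (δ : ℝ) : MeasurableSet (outerLayer Ω δ) := by
  rw [outerLayer, outerDomain_eq_thickening]
  exact Metric.isOpen_thickening.measurableSet.diff isClosed_closure.measurableSet

/-! ### Areas of exit sets and layers, by convexity -/

theorem measureReal_homothety (p : Plane) (r : ℝ) (s : Set Plane) :
    volume.real (AffineMap.homothety p r '' s) = r ^ 2 * volume.real s := by
  rw [measureReal_def, Measure.addHaar_image_homothety, ENNReal.toReal_mul, finrank_euclideanSpace,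
    Fintype.card_fin, abs_of_nonneg (sq_nonneg r), ENNReal.toReal_ofReal (sq_nonneg r),
    measureReal_def]

/-- The points of `Ω` that the translation by `z` moves out of `Ω`. -/
def exitSet (Ω : Set Plane) (z : Plane) : Set Plane := {x | x ∈ Ω ∧ x + z ∉ Ω}

/-- Shrink `Ω` towards `p` by the factor `1 - t`, where `t = ‖z‖ / ρ'`. A point `(1 - t) w + t p` of
the shrunken copy, moved by `z`, is `(1 - t) w + t (p + z / t)`, again in `Ω`. Hence the exit set
lies in the difference of `Ω` and the copy, of area at most `2t |Ω|`. For large `z` the whole area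
of `Ω` is an adequate bound. -/
theorem exists_measureReal_exitSet_le {Ω : Set Plane} (hΩ : IsOpen Ω) (hc : Convex ℝ Ω)
    (hb : Bornology.IsBounded Ω) :
    ∃ C : ℝ, 0 ≤ C ∧ ∀ z : Plane, volume.real (exitSet Ω z) ≤ C * ‖z‖ := by
  rcases Ω.eq_empty_or_nonempty with rfl | ⟨p, hp⟩
  · exact ⟨0, le_rfl, by simp [exitSet]⟩
  obtain ⟨ρ, hρ, hball⟩ := Metric.isOpen_iff.1 hΩ p hp
  have hfin : volume Ω ≠ ⊤ := hb.measure_lt_top.ne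
  -- The point `p + z / t` lies at distance exactly `ρ'` from `p`, which must be strictly below the
  -- radius `ρ` of the ball.
  set ρ' := ρ / 2
  have hρ' : 0 < ρ' := by positivity
  refine ⟨2 * volume.real Ω / ρ', by positivity, fun z => ?_⟩
  rcases le_or_gt ρ' ‖z‖ with h | h
  · calc volume.real (exitSet Ω z) ≤ volume.real Ω :=
          measureReal_mono (fun x hx => hx.1) hfin
      _ = volume.real Ω / ρ' * ρ' := by field_simp
      _ ≤ volume.real Ω / ρ' * ‖z‖ := by gcongr
      _ ≤ 2 * (volume.real Ω / ρ' * ‖z‖) := by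
          have : 0 ≤ volume.real Ω / ρ' * ‖z‖ := by positivity
          linarith
      _ = _ := by ring
  rcases eq_or_ne z 0 with rfl | hz
  · have : exitSet Ω 0 = ∅ := by ext x; simp [exitSet]
    rw [this]; simp
  set t := ‖z‖ / ρ'
  have ht0 : 0 < t := by have := norm_pos_iff.2 hz; positivity
  have ht1 : t < 1 := (div_lt_one hρ').2 h
  set A := AffineMap.homothety p (1 - t) '' Ω
  have hAsub : A ⊆ Ω := by
    rintro _ ⟨w, hw, rfl⟩
    rw [AffineMap.homothety_apply]
    have := hc hw hp (a := 1 - t) (b := t) (by linarith) ht0.le (by ring)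
    convert this using 1
    simp only [vsub_eq_sub, vadd_eq_add]
    module
  have hAopen : IsOpen A := by
    have := AffineMap.homothety_isOpenMap p (1 - t) (by linarith)
    exact this _ hΩ
  calc volume.real (exitSet Ω z) ≤ volume.real (Ω \ A) := by
        refine measureReal_mono (fun x hx => ⟨hx.1, ?_⟩)
          (measure_ne_top_of_subset sdiff_subset hfin)
        rintro ⟨w, hw, rfl⟩
        apply hx.2
        have hq : p + t⁻¹ • z ∈ Ω := by
          apply hball
          rw [Metric.mem_ball, dist_self_add_left, norm_smul, norm_inv, Real.norm_of_nonneg ht0.le]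
          have : t⁻¹ * ‖z‖ = ρ' := by
            have := norm_pos_iff.2 hz
            simp only [t]; field_simp
          rw [this]; simp only [ρ']; linarith
        have := hc hw hq (a := 1 - t) (b := t) (by linarith) ht0.le (by ring)
        convert this using 1
        rw [AffineMap.homothety_apply, smul_add, smul_smul, mul_inv_cancel₀ ht0.ne']
        simp only [vsub_eq_sub, vadd_eq_add]
        module
    _ = volume.real Ω - (1 - t) ^ 2 * volume.real Ω := by
        rw [measureReal_sdiff hAsub hAopen.measurableSet hfin, measureReal_homothety]
    _ ≤ 2 * t * volume.real Ω := by
        have : 0 ≤ volume.real Ω := measureReal_nonneg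
        nlinarith [mul_nonneg (sq_nonneg t) this]
    _ = _ := by simp only [t]; ring

/-- Dual to the shrinking argument: the dilation of `Ω` about `p` by `1 + t`, `t = δ / ρ`, contains
the `δ`-neighbourhood of `Ω`. The factor 3 comes from `(1 + t)² - 1 ≤ 3t` for `t < 1`. -/
theorem exists_measureReal_outerLayer_le {Ω : Set Plane} (hΩ : IsOpen Ω) (hc : Convex ℝ Ω)
    (hb : Bornology.IsBounded Ω) :
    ∃ C ρ : ℝ, 0 ≤ C ∧ 0 < ρ ∧ ∀ δ, 0 < δ → δ < ρ → volume.real (outerLayer Ω δ) ≤ C * δ := by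
  rcases Ω.eq_empty_or_nonempty with rfl | ⟨p, hp⟩
  · exact ⟨0, 1, le_rfl, one_pos, by simp [outerLayer, outerDomain_eq_thickening]⟩
  obtain ⟨ρ, hρ, hball⟩ := Metric.isOpen_iff.1 hΩ p hp
  have hfin : volume Ω ≠ ⊤ := hb.measure_lt_top.ne
  refine ⟨3 * volume.real Ω / ρ, ρ, by positivity, hρ, fun δ hδ hδρ => ?_⟩
  set t := δ / ρ
  have ht0 : 0 < t := by positivity
  have ht1 : t < 1 := (div_lt_one hρ).2 hδρ
  set A := AffineMap.homothety p (1 + t) '' Ω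
  have hAfin : volume A ≠ ⊤ := by
    simp only [A, Measure.addHaar_image_homothety]
    finiteness
  have hsub : outerDomain Ω δ ⊆ A := by
    intro y hy
    rw [outerDomain_eq_thickening, Metric.mem_thickening_iff] at hy
    obtain ⟨x, hx, hyx⟩ := hy
    have hq : p + t⁻¹ • (y - x) ∈ Ω := by
      apply hball
      rw [Metric.mem_ball, dist_self_add_left, norm_smul, norm_inv, Real.norm_of_nonneg ht0.le,
        ← dist_eq_norm]
      calc t⁻¹ * dist y x < t⁻¹ * δ := by gcongr
        _ = ρ := by simp only [t]; field_simp
    refine ⟨_, hc hx hq (a := 1 / (1 + t)) (b := t / (1 + t)) (by positivity) (by positivity)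
      (by field_simp), ?_⟩
    have h1 : (1 + t) ≠ 0 := by positivity
    rw [AffineMap.homothety_apply]
    simp only [vsub_eq_sub, vadd_eq_add, smul_sub, smul_add, smul_smul]
    rw [mul_one_div_cancel h1, mul_div_cancel₀ _ h1, ← mul_assoc, mul_div_cancel₀ _ h1,
      mul_inv_cancel₀ ht0.ne']
    module
  have hΩA : Ω ⊆ A := by
    refine Subset.trans ?_ hsub
    rw [outerDomain_eq_thickening]
    exact Metric.self_subset_thickening hδ Ω
  calc volume.real (outerLayer Ω δ) ≤ volume.real (A \ Ω) :=
        measureReal_mono (fun x hx => ⟨hsub hx.1, fun h => hx.2 (subset_closure h)⟩)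
          (measure_ne_top_of_subset sdiff_subset hAfin)
    _ = (1 + t) ^ 2 * volume.real Ω - volume.real Ω := by
        rw [measureReal_sdiff hΩA hΩ.measurableSet hAfin, measureReal_homothety]
    _ ≤ 3 * t * volume.real Ω := by
        have : 0 ≤ volume.real Ω := measureReal_nonneg
        nlinarith [mul_nonneg (mul_nonneg ht0.le (by linarith : 0 ≤ 1 - t)) this]
    _ = _ := by simp only [t]; ring

/-! ### The outward normal -/

/-- The determinant of two plane vectors. -/
def cross (a b : Plane) : ℝ := a 0 * b 1 - a 1 * b 0

theorem cross_smul_right (t : ℝ) (a b : Plane) : cross a (t • b) = t * cross a b := by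
  simp [cross]; ring

theorem norm_sq_plane (a : Plane) : ‖a‖ ^ 2 = a 0 ^ 2 + a 1 ^ 2 := by
  rw [EuclideanSpace.norm_sq_eq, Fin.sum_univ_two]; simp

theorem inner_curveNormal_mul {Γ : ℝ → Plane} {η : ℝ} (h : deriv Γ η ≠ 0) (a : Plane) :
    inner ℝ a (curveNormal Γ η) * ‖deriv Γ η‖ = cross a (deriv Γ η) := by
  have : ‖deriv Γ η‖ ≠ 0 := norm_ne_zero_iff.2 h
  rw [curveNormal, inner_smul_right, PiLp.inner_apply, Fin.sum_univ_two]
  simp [cross]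
  field_simp
  ring

theorem continuousLinearMap_plane (f : Plane →L[ℝ] ℝ) (a : Plane) :
    f a = a 0 * f (EuclideanSpace.single 0 1) + a 1 * f (EuclideanSpace.single 1 1) := by
  have : a = a 0 • EuclideanSpace.single 0 (1 : ℝ) + a 1 • EuclideanSpace.single 1 (1 : ℝ) := by
    ext i; fin_cases i <;> simp
  conv_lhs => rw [this]
  simp

theorem norm_curveNormal {Γ : ℝ → Plane} {η : ℝ} (h : deriv Γ η ≠ 0) : ‖curveNormal Γ η‖ = 1 := by
  have h0 : ‖deriv Γ η‖ ≠ 0 := norm_ne_zero_iff.2 h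
  have h1 : ‖(!₂[deriv Γ η 1, -(deriv Γ η 0)] : Plane)‖ = ‖deriv Γ η‖ := by
    rw [← sq_eq_sq₀ (norm_nonneg _) (norm_nonneg _), norm_sq_plane, norm_sq_plane]
    simp; ring
  rw [curveNormal, norm_smul, h1, norm_inv, norm_norm, inv_mul_cancel₀ h0]

theorem norm_outwardNormal (Ω : Set Plane) {Γ : ℝ → Plane} {η : ℝ} (h : deriv Γ η ≠ 0) :
    ‖outwardNormal Ω Γ η‖ = 1 := by
  rw [outwardNormal]
  split_ifs
  · exact norm_curveNormal h
  · rw [norm_neg, norm_curveNormal h]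

/-- A supporting functional at `Γ η` is maximal along the curve there, so it annihilates the tangent
and is a multiple of `cross · (deriv Γ η)`. Therefore `cross (Γ η - p) (deriv Γ η)` never vanishes,
and by continuity its sign is constant. One sign `ε` thus orients the normal along the whole curve;
this also makes `outwardNormal` usable in continuity arguments. -/
theorem exists_outwardNormal_sign {Ω : Set Plane} (hΩ : IsOpen Ω) (hc : Convex ℝ Ω)
    {Γ : ℝ → Plane} {L : ℝ} (hΓ : IsClosedC2Curve Γ L (frontier Ω)) {p : Plane} (hp : p ∈ Ω) :
    ∃ ε : ℝ, ∀ η, 0 < ε * cross (Γ η - p) (deriv Γ η) ∧ |ε| = 1 ∧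
      outwardNormal Ω Γ η = ε • curveNormal Γ η := by
  have hd : Differentiable ℝ Γ := hΓ.contDiff.differentiable (by norm_num)
  have key : ∀ η, ∃ k : ℝ, 0 < k * cross (Γ η - p) (deriv Γ η) ∧
      ∀ x ∈ Ω, k * cross (x - Γ η) (deriv Γ η) < 0 := by
    intro η
    have hη : Γ η ∉ Ω := by
      have : Γ η ∈ frontier Ω := hΓ.range_eq ▸ mem_range_self η
      rw [hΩ.frontier_eq] at this
      exact this.2
    obtain ⟨f, hf⟩ := geometric_hahn_banach_open_point hc hΩ hη
    have hle : ∀ t, f (Γ t) ≤ f (Γ η) := by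
      intro t
      have ht : Γ t ∈ closure Ω := frontier_subset_closure (hΓ.range_eq ▸ mem_range_self t)
      exact closure_minimal (fun x hx => (hf x hx).le)
        (isClosed_le f.continuous continuous_const) ht
    have h0 : f (deriv Γ η) = 0 := by
      have h1 : HasDerivAt (fun t => f (Γ t)) (f (deriv Γ η)) η :=
        f.hasFDerivAt.comp_hasDerivAt η (hd η).hasDerivAt
      exact IsLocalMax.hasDerivAt_eq_zero (Filter.Eventually.of_forall hle) h1
    have hpos : 0 < ‖deriv Γ η‖ ^ 2 := by
      have := norm_pos_iff.2 (hΓ.regular η); positivity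
    have hrep : ∀ a : Plane, ‖deriv Γ η‖ ^ 2 * f a =
        (f (EuclideanSpace.single 0 1) * deriv Γ η 1 - f (EuclideanSpace.single 1 1) * deriv Γ η 0)
          * cross a (deriv Γ η) := by
      intro a
      rw [continuousLinearMap_plane] at h0
      rw [continuousLinearMap_plane f a, norm_sq_plane, cross]
      linear_combination (a 0 * deriv Γ η 0 + a 1 * deriv Γ η 1) * h0
    refine ⟨f (EuclideanSpace.single 0 1) * deriv Γ η 1 - f (EuclideanSpace.single 1 1) *
      deriv Γ η 0, ?_, fun x hx => ?_⟩
    · rw [← hrep, map_sub]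
      exact mul_pos hpos (by linarith [hf p hp])
    · rw [← hrep, map_sub]
      exact mul_neg_of_pos_of_neg hpos (by linarith [hf x hx])
  have hcont : Continuous fun η => cross (Γ η - p) (deriv Γ η) := by
    have h1 : Continuous Γ := hΓ.contDiff.continuous
    have h2 : Continuous (deriv Γ) := hΓ.contDiff.continuous_deriv (by norm_num)
    unfold cross
    fun_prop
  have hne : ∀ η, cross (Γ η - p) (deriv Γ η) ≠ 0 := by
    intro η h
    obtain ⟨k, hk, -⟩ := key η
    simp [h] at hk
  have hneg : ∀ a b : Plane, cross (a - b) = - cross (b - a) := by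
    intro a b; ext c; simp [cross]; ring
  have houtpos : ∀ η, 0 < cross (Γ η - p) (deriv Γ η) →
      outwardNormal Ω Γ η = curveNormal Γ η := by
    intro η h
    obtain ⟨k, hk, hk'⟩ := key η
    have hk0 : 0 < k := pos_of_mul_pos_left hk h.le
    rw [outwardNormal, if_pos]
    intro x hx
    have h3 : cross (x - Γ η) (deriv Γ η) < 0 := by
      by_contra! h4
      exact absurd (hk' x hx) (not_lt.2 (mul_nonneg hk0.le h4))
    rw [← inner_curveNormal_mul (hΓ.regular η)] at h3
    by_contra! h4
    exact absurd h3 (not_lt.2 (mul_nonneg h4.le (norm_nonneg _)))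
  have houtneg : ∀ η, cross (Γ η - p) (deriv Γ η) < 0 →
      outwardNormal Ω Γ η = - curveNormal Γ η := by
    intro η h
    rw [outwardNormal, if_neg]
    intro hall
    have h3 := mul_nonpos_of_nonpos_of_nonneg (hall p hp) (norm_nonneg (deriv Γ η))
    rw [inner_curveNormal_mul (hΓ.regular η), hneg] at h3
    simp only [Pi.neg_apply] at h3
    linarith
  by_cases hall : ∀ η, 0 < cross (Γ η - p) (deriv Γ η)
  · exact ⟨1, fun η => ⟨by simpa using hall η, by simp, by simpa using houtpos η (hall η)⟩⟩
  · push Not at hall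
    obtain ⟨a, ha⟩ := hall
    have hall' : ∀ η, cross (Γ η - p) (deriv Γ η) < 0 := by
      intro b
      by_contra! hb
      obtain ⟨c, hc⟩ := mem_range_of_exists_le_of_exists_ge hcont ⟨a, ha⟩ ⟨b, hb⟩
      exact hne c hc
    exact ⟨-1, fun η => ⟨by linarith [hall' η], by simp, by simpa using houtneg η (hall' η)⟩⟩

/-! ### The divergence theorem on a convex domain -/

/-- The coordinates of a plane vector. -/
def planeEquiv : Plane ≃ᵐ ℝ × ℝ :=
  (MeasurableEquiv.toLp 2 (Fin 2 → ℝ)).symm.trans MeasurableEquiv.finTwoArrow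

theorem planeEquiv_apply (w : Plane) : planeEquiv w = (w 0, w 1) := rfl

theorem measurePreserving_planeEquiv : MeasurePreserving planeEquiv :=
  (volume_preserving_finTwoArrow ℝ).comp (PiLp.volume_preserving_ofLp (Fin 2))

/-- The linear map of the plane with columns `a` and `b`. -/
def columns (a b : Plane) : Plane →L[ℝ] Plane :=
  (EuclideanSpace.proj (0 : Fin 2) : Plane →L[ℝ] ℝ).smulRight a +
    (EuclideanSpace.proj (1 : Fin 2) : Plane →L[ℝ] ℝ).smulRight b

theorem columns_apply (a b w : Plane) : columns a b w = w 0 • a + w 1 • b := rfl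

theorem det_columns (a b : Plane) : (columns a b).det = cross a b := by
  rw [ContinuousLinearMap.det,
    ← LinearMap.det_toMatrix (EuclideanSpace.basisFun (Fin 2) ℝ).toBasis, Matrix.det_fin_two]
  simp [LinearMap.toMatrix_apply, columns_apply, cross]
  ring

/-- The cone over the curve `Γ` with apex `p`. -/
def cone (Γ : ℝ → Plane) (p : Plane) (q : ℝ × ℝ) : Plane := p + q.1 • (Γ q.2 - p)

theorem add_smul_sub_mem {Ω : Set Plane} (hΩ : IsOpen Ω) (hc : Convex ℝ Ω) {p q : Plane}
    (hp : p ∈ Ω) (hq : q ∈ closure Ω) {t : ℝ} (h0 : 0 ≤ t) (h1 : t < 1) :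
    p + t • (q - p) ∈ Ω := by
  rcases h0.eq_or_lt with rfl | h0
  · simpa using hp
  rw [← hΩ.interior_eq] at hp ⊢
  exact hc.openSegment_interior_closure_subset_interior hp hq
    ⟨1 - t, t, by linarith, h0, by ring, by module⟩

theorem IsClosedC2Curve.mem_closure {Ω : Set Plane} {Γ : ℝ → Plane} {L : ℝ}
    (hΓ : IsClosedC2Curve Γ L (frontier Ω)) (η : ℝ) : Γ η ∈ closure Ω :=
  frontier_subset_closure (hΓ.range_eq ▸ mem_range_self η)

theorem IsClosedC2Curve.notMem {Ω : Set Plane} (hΩ : IsOpen Ω) {Γ : ℝ → Plane} {L : ℝ}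
    (hΓ : IsClosedC2Curve Γ L (frontier Ω)) (η : ℝ) : Γ η ∉ Ω := by
  have : Γ η ∈ frontier Ω := hΓ.range_eq ▸ mem_range_self η
  rw [hΩ.frontier_eq] at this
  exact this.2

/-- Each ray from `p` meets the curve once: of two curve points on one ray, the nearer would lie in
`Ω` by convexity. -/
theorem injOn_cone {Ω : Set Plane} (hΩ : IsOpen Ω) (hc : Convex ℝ Ω) {Γ : ℝ → Plane} {L : ℝ}
    (hΓ : IsClosedC2Curve Γ L (frontier Ω)) {p : Plane} (hp : p ∈ Ω) :
    InjOn (cone Γ p) (Ioo 0 1 ×ˢ Ico 0 L) := by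
  have key : ∀ t ∈ Ioo (0 : ℝ) 1, ∀ t' ∈ Ioo (0 : ℝ) 1, ∀ η η',
      t • (Γ η - p) = t' • (Γ η' - p) → ¬ t < t' := by
    intro t ht t' ht' η η' h hlt
    apply hΓ.notMem hΩ η'
    have := add_smul_sub_mem hΩ hc hp (hΓ.mem_closure η) (t := t / t')
      (div_nonneg ht.1.le ht'.1.le) ((div_lt_one ht'.1).2 hlt)
    rwa [div_eq_inv_mul, mul_smul, h, smul_smul, inv_mul_cancel₀ ht'.1.ne', one_smul,
      add_sub_cancel] at this
  rintro ⟨t, η⟩ ⟨ht, hη⟩ ⟨t', η'⟩ ⟨ht', hη'⟩ h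
  simp only [cone, add_right_inj] at h ht hη ht' hη'
  have htt : t = t' := le_antisymm (not_lt.1 (key _ ht' _ ht _ _ h.symm))
    (not_lt.1 (key _ ht _ ht' _ _ h))
  subst htt
  have h2 : Γ η = Γ η' := sub_left_injective (smul_right_injective _ ht.1.ne' h)
  rw [hΓ.injOn hη hη' h2]

/-- Boundedness forces the ray from `p` through `x` to leave `Ω`; it does so at a curve point `p + r
(x - p)` with `r > 1`, and `1 / r` is the cone parameter of `x`. -/
theorem image_cone {Ω : Set Plane} (hΩ : IsOpen Ω) (hc : Convex ℝ Ω) {Γ : ℝ → Plane} {L : ℝ}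
    (hΓ : IsClosedC2Curve Γ L (frontier Ω)) {p : Plane} (hp : p ∈ Ω) (hb : Bornology.IsBounded Ω) :
    cone Γ p '' (Ioo 0 1 ×ˢ Ico 0 L) = Ω \ {p} := by
  apply Subset.antisymm
  · rintro _ ⟨⟨t, η⟩, ⟨ht, hη⟩, rfl⟩
    refine ⟨add_smul_sub_mem hΩ hc hp (hΓ.mem_closure η) ht.1.le ht.2, fun h => ?_⟩
    simp only [cone, mem_singleton_iff, add_eq_left, smul_eq_zero, sub_eq_zero] at h
    rcases h with h | h
    · exact ht.1.ne' h
    · exact hΓ.notMem hΩ η (h ▸ hp)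
  · rintro x ⟨hx, hxp⟩
    have hxp' : 0 < ‖x - p‖ := norm_pos_iff.2 (sub_ne_zero.2 hxp)
    obtain ⟨R, hR⟩ := hb.subset_closedBall p
    obtain ⟨n, hn⟩ := exists_nat_gt (R / ‖x - p‖)
    have hy : p + (n + 1 : ℝ) • (x - p) ∉ Ω := by
      intro h
      have := hR h
      rw [Metric.mem_closedBall, dist_self_add_left, norm_smul,
        Real.norm_of_nonneg (by positivity)] at this
      rw [div_lt_iff₀ hxp'] at hn
      nlinarith
    obtain ⟨q, hq, hqf⟩ := exists_mem_segment_frontier hx hy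
    rw [segment_eq_image'] at hq
    obtain ⟨s, hs, rfl⟩ := hq
    set r := 1 + s * n
    have hr : 1 ≤ r := le_add_of_nonneg_right (mul_nonneg hs.1 (Nat.cast_nonneg n))
    have hq : x + s • (p + (n + 1 : ℝ) • (x - p) - x) = p + r • (x - p) := by
      simp only [r]; module
    simp only [hq] at hqf
    rw [← hΓ.range_eq] at hqf
    obtain ⟨η₀, hη₀⟩ := hqf
    obtain ⟨η, hη, hηη⟩ := hΓ.periodic.exists_mem_Ico₀ hΓ.period_pos η₀
    have hΓη : Γ η = p + r • (x - p) := by rw [← hηη, hη₀]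
    have hr1 : 1 < r := by
      refine lt_of_le_of_ne hr fun h => hΓ.notMem hΩ η ?_
      rw [hΓη, ← h]; simpa using hx
    have hr0 : 0 < r := by linarith
    refine ⟨(r⁻¹, η), ⟨⟨inv_pos.2 hr0, inv_lt_one_of_one_lt₀ hr1⟩, hη⟩, ?_⟩
    simp only [cone, hΓη, add_sub_cancel_left, smul_smul, inv_mul_cancel₀ hr0.ne', one_smul,
      add_sub_cancel]

theorem hasFDerivAt_cone {Ω : Set Plane} {Γ : ℝ → Plane} {L : ℝ}
    (hΓ : IsClosedC2Curve Γ L (frontier Ω)) {p : Plane} (w : Plane) :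
    HasFDerivAt (fun w : Plane => cone Γ p (w 0, w 1))
      (columns (Γ (w 1) - p) (w 0 • deriv Γ (w 1))) w := by
  have h0 : HasFDerivAt (fun w : Plane => w 0)
      (EuclideanSpace.proj (0 : Fin 2) : Plane →L[ℝ] ℝ) w :=
    (EuclideanSpace.proj (0 : Fin 2) : Plane →L[ℝ] ℝ).hasFDerivAt
  have h1 : HasFDerivAt (fun w : Plane => w 1)
      (EuclideanSpace.proj (1 : Fin 2) : Plane →L[ℝ] ℝ) w :=
    (EuclideanSpace.proj (1 : Fin 2) : Plane →L[ℝ] ℝ).hasFDerivAt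
  have hd : HasDerivAt Γ (deriv Γ (w 1)) (w 1) :=
    (hΓ.contDiff.differentiable (by norm_num) _).hasDerivAt
  have h2 := (h0.smul ((hd.hasFDerivAt.comp w h1).sub_const p)).const_add p
  refine h2.congr_fderiv ?_
  ext v : 1
  simp only [columns_apply, add_apply, smul_apply,
    ContinuousLinearMap.smulRight_apply, ContinuousLinearMap.comp_apply, Function.comp]
  simp [smul_smul, mul_comm]
  module

/-- Change of variables with Jacobian `t · cross (Γ - p) Γ'`. The apex and the edges of the
parameter rectangle are null sets. -/
theorem setIntegral_eq_integral_cone {Ω : Set Plane} (hΩ : IsOpen Ω) (hc : Convex ℝ Ω)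
    {Γ : ℝ → Plane} {L : ℝ}
    (hΓ : IsClosedC2Curve Γ L (frontier Ω)) {p : Plane} (hp : p ∈ Ω)
    (hb : Bornology.IsBounded Ω) (F : Plane → ℝ) :
    ∫ x in Ω, F x = ∫ q in Icc ((0 : ℝ), (0 : ℝ)) (1, L),
      |q.1 * cross (Γ q.2 - p) (deriv Γ q.2)| * F (cone Γ p q) := by
  set Q : Set (ℝ × ℝ) := Ioo 0 1 ×ˢ Ico 0 L
  have hQ : MeasurableSet Q := measurableSet_Ioo.prod measurableSet_Ico
  have himg : (fun w : Plane => cone Γ p (w 0, w 1)) '' (planeEquiv ⁻¹' Q) = Ω \ {p} := by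
    rw [← image_cone hΩ hc hΓ hp hb, ← planeEquiv.image_symm, image_image]
    refine image_congr fun q _ => ?_
    have := planeEquiv_apply (planeEquiv.symm q)
    rw [planeEquiv.apply_symm_apply] at this
    rw [← this]
  have hinj : InjOn (fun w : Plane => cone Γ p (w 0, w 1)) (planeEquiv ⁻¹' Q) := by
    intro w hw w' hw' h
    exact planeEquiv.injective (injOn_cone hΩ hc hΓ hp hw hw' h)
  have h1 := integral_image_eq_integral_abs_det_fderiv_smul volume (planeEquiv.measurable hQ)
    (fun w _ => (hasFDerivAt_cone hΓ (p := p) w).hasFDerivWithinAt) hinj F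
  rw [himg, setIntegral_congr_set (sdiff_null_ae_eq_self (measure_singleton p))] at h1
  rw [h1]
  have h2 := measurePreserving_planeEquiv.setIntegral_preimage_emb
    planeEquiv.measurableEmbedding
    (fun q : ℝ × ℝ => |q.1 * cross (Γ q.2 - p) (deriv Γ q.2)| * F (cone Γ p q)) Q
  simp only [planeEquiv_apply] at h2
  simp only [det_columns, cross_smul_right, smul_eq_mul]
  rw [h2, ← Icc_prod_Icc]
  exact setIntegral_congr_set (Measure.set_prod_ae_eq Ioo_ae_eq_Icc Ico_ae_eq_Icc)

/-- The linear relation `(cross e b) a - (cross e a) b = (cross a b) e` between three plane vectors,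
under `D`. -/
theorem fderiv_cross_identity (D : Plane →L[ℝ] ℝ) (a b e : Plane) :
    D a * cross e b - D b * cross e a = D e * cross a b := by
  rw [continuousLinearMap_plane D a, continuousLinearMap_plane D b, continuousLinearMap_plane D e]
  simp only [cross]; ring

theorem contDiff_cross {E : Type*} [NormedAddCommGroup E] [NormedSpace ℝ E] {n : WithTop ℕ∞}
    {a : E → Plane} (ha : ContDiff ℝ n a) (e : Plane) : ContDiff ℝ n fun x => cross e (a x) := by
  have h := contDiff_euclidean.1 ha
  exact (contDiff_const.mul (h 1)).sub (contDiff_const.mul (h 0))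

theorem hasDerivAt_cross {a : ℝ → Plane} {a' : Plane} {t : ℝ} (ha : HasDerivAt a a' t)
    (e : Plane) : HasDerivAt (fun x => cross e (a x)) (cross e a') t := by
  have h := fun i : Fin 2 =>
    (EuclideanSpace.proj i : Plane →L[ℝ] ℝ).hasFDerivAt.comp_hasDerivAt t ha
  exact ((h 1).const_mul (e 0)).sub ((h 0).const_mul (e 1))

/-- The divergence theorem on a cone over a closed curve, with the apex as base point. -/
theorem integral_cone_fderiv {Γ : ℝ → Plane} {L : ℝ} (hL : 0 < L) (hΓ : ContDiff ℝ 2 Γ)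
    (hper : Function.Periodic Γ L) (p e : Plane) {f : Plane → ℝ} (hf : ContDiff ℝ 1 f) :
    ∫ q in Icc ((0 : ℝ), (0 : ℝ)) (1, L),
      q.1 * cross (Γ q.2 - p) (deriv Γ q.2) * fderiv ℝ f (cone Γ p q) e =
    ∫ η in (0 : ℝ)..L, f (Γ η) * cross e (deriv Γ η) := by
  have hΓ' : ContDiff ℝ 1 (deriv Γ) := (contDiff_succ_iff_deriv (n := 1).1 hΓ).2.2
  have hΓ1 : ContDiff ℝ 1 Γ := hΓ.of_le (by norm_num)
  have hcone : ContDiff ℝ 1 (cone Γ p) :=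
    contDiff_const.add (contDiff_fst.smul ((hΓ1.comp contDiff_snd).sub contDiff_const))
  -- `A` and `-B` are the `dη` and `dt` coefficients of the 1-form `f · cross e dx` pulled back by
  -- the cone. In `∂_t A + ∂_η B` the terms `f · cross e Γ'` cancel. `Γ` of class `C²` is what makes
  -- `A` of class `C¹`.
  set A : ℝ × ℝ → ℝ := fun q => f (cone Γ p q) * (q.1 * cross e (deriv Γ q.2))
  set B : ℝ × ℝ → ℝ := fun q => -(f (cone Γ p q) * cross e (Γ q.2 - p))
  have hA : ContDiff ℝ 1 A :=
    (hf.comp hcone).mul (contDiff_fst.mul (contDiff_cross (hΓ'.comp contDiff_snd) e))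
  have hB : ContDiff ℝ 1 B :=
    ((hf.comp hcone).mul (contDiff_cross ((hΓ1.comp contDiff_snd).sub contDiff_const) e)).neg
  have hdf : ∀ x, HasFDerivAt f (fderiv ℝ f x) x := fun x =>
    (hf.differentiable one_ne_zero x).hasFDerivAt
  have hdA : ∀ q : ℝ × ℝ, fderiv ℝ A q (1, 0) =
      fderiv ℝ f (cone Γ p q) (Γ q.2 - p) * (q.1 * cross e (deriv Γ q.2)) +
        f (cone Γ p q) * cross e (deriv Γ q.2) := by
    rintro ⟨t, η⟩
    have h1 : HasDerivAt (fun s : ℝ => (s, η)) ((1 : ℝ), (0 : ℝ)) t :=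
      (hasDerivAt_id t).prodMk (hasDerivAt_const t η)
    have h2 := (hA.differentiable one_ne_zero (t, η)).hasFDerivAt.comp_hasDerivAt t h1
    have h3 : HasDerivAt (fun s : ℝ => cone Γ p (s, η)) (Γ η - p) t := by
      simpa [cone] using ((hasDerivAt_id t).smul_const (Γ η - p)).const_add p
    have h4 := ((hdf (cone Γ p (t, η))).comp_hasDerivAt t h3).mul
      ((hasDerivAt_id t).mul_const (cross e (deriv Γ η)))
    have := h2.unique h4
    simpa using this
  have hdB : ∀ q : ℝ × ℝ, fderiv ℝ B q (0, 1) =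
      -(fderiv ℝ f (cone Γ p q) (deriv Γ q.2) * q.1 * cross e (Γ q.2 - p) +
        f (cone Γ p q) * cross e (deriv Γ q.2)) := by
    rintro ⟨t, η⟩
    have hd : HasDerivAt Γ (deriv Γ η) η := (hΓ.differentiable (by norm_num) _).hasDerivAt
    have h1 : HasDerivAt (fun s : ℝ => (t, s)) ((0 : ℝ), (1 : ℝ)) η :=
      (hasDerivAt_const η t).prodMk (hasDerivAt_id η)
    have h2 := (hB.differentiable one_ne_zero (t, η)).hasFDerivAt.comp_hasDerivAt η h1
    have h3 : HasDerivAt (fun s : ℝ => cone Γ p (t, s)) (t • deriv Γ η) η :=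
      ((hd.sub_const p).const_smul t).const_add p
    have h4 := (((hdf (cone Γ p (t, η))).comp_hasDerivAt η h3).mul
      (hasDerivAt_cross (hd.sub_const p) e)).neg
    have := h2.unique h4
    simpa [mul_comm, mul_assoc, mul_left_comm] using this
  have hcA : Continuous fun q => fderiv ℝ A q (1, 0) :=
    (hA.continuous_fderiv one_ne_zero).clm_apply continuous_const
  have hcB : Continuous fun q => fderiv ℝ B q (0, 1) :=
    (hB.continuous_fderiv one_ne_zero).clm_apply continuous_const
  have main := integral_divergence_prod_Icc_of_hasFDerivAt_of_le A B (fderiv ℝ A) (fderiv ℝ B)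
    (0, 0) (1, L) ⟨zero_le_one, hL.le⟩ hA.continuous.continuousOn hB.continuous.continuousOn
    (fun x _ => (hA.differentiable one_ne_zero x).hasFDerivAt)
    (fun x _ => (hB.differentiable one_ne_zero x).hasFDerivAt)
    ((hcA.add hcB).continuousOn.integrableOn_compact isCompact_Icc)
  -- The edges `η = 0` and `η = L` cancel by periodicity and the edge `t = 0` carries the factor `t
  -- = 0`; only `t = 1`, the curve itself, remains.
  have hL0 : Γ L = Γ 0 := by simpa using hper 0
  have hBL : ∀ x, B (x, L) = B (x, 0) := by intro x; simp only [B, cone, hL0]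
  simp only [hBL, sub_self, zero_add] at main
  have hA1 : ∀ η, A (1, η) = f (Γ η) * cross e (deriv Γ η) := by intro η; simp [A, cone]
  have hA0 : ∀ η, A (0, η) = 0 := by intro η; simp [A]
  simp only [hA1, hA0, intervalIntegral.integral_zero, sub_zero] at main
  rw [← main]
  refine integral_congr_ae (Filter.Eventually.of_forall fun q => ?_)
  simp only [hdA, hdB]
  linear_combination -q.1 * fderiv_cross_identity (fderiv ℝ f (cone Γ p q)) (Γ q.2 - p)
    (deriv Γ q.2) e

/-- The divergence theorem on a convex domain with boundary curve `Γ`. -/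
theorem setIntegral_fderiv_eq_boundary {Ω : Set Plane} (hΩ : IsOpen Ω) (hc : Convex ℝ Ω)
    (hb : Bornology.IsBounded Ω) {Γ : ℝ → Plane} {L : ℝ}
    (hΓ : IsClosedC2Curve Γ L (frontier Ω)) {p : Plane} (hp : p ∈ Ω) {f : Plane → ℝ}
    (hf : ContDiff ℝ 1 f) (e : Plane) :
    ∫ x in Ω, fderiv ℝ f x e =
      ∫ η in (0 : ℝ)..L, f (Γ η) * (inner ℝ e (outwardNormal Ω Γ η) * ‖deriv Γ η‖) := by
  obtain ⟨ε, hε⟩ := exists_outwardNormal_sign hΩ hc hΓ hp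
  have h1 : ∀ η, inner ℝ e (outwardNormal Ω Γ η) * ‖deriv Γ η‖ = ε * cross e (deriv Γ η) := by
    intro η
    rw [(hε η).2.2, inner_smul_right, mul_assoc, inner_curveNormal_mul (hΓ.regular η)]
  simp only [h1, mul_left_comm _ ε]
  rw [intervalIntegral.integral_const_mul,
    ← integral_cone_fderiv hΓ.period_pos hΓ.contDiff hΓ.periodic p e hf,
    setIntegral_eq_integral_cone hΩ hc hΓ hp hb, ← integral_const_mul]
  refine setIntegral_congr_fun measurableSet_Icc fun q hq => ?_
  -- The sign that turns the normal outward is also the sign of the Jacobian.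
  obtain ⟨h2, h3, -⟩ := hε q.2
  have h4 : |cross (Γ q.2 - p) (deriv Γ q.2)| = ε * cross (Γ q.2 - p) (deriv Γ q.2) := by
    rw [← abs_of_pos h2, abs_mul, h3, one_mul]
  simp only [abs_mul, h4, abs_of_nonneg hq.1.1]
  ring

/-! ### Moments of a radial kernel -/

/-- The kernel `z ↦ g |z|`, cut off to the open disc of radius `δ`. -/
def truncKernel (δ : ℝ) (g : ℝ → ℝ) (z : Plane) : ℝ := (Iio δ).indicator g ‖z‖

theorem truncKernel_of_le {δ : ℝ} {g : ℝ → ℝ} {z : Plane} (h : δ ≤ ‖z‖) :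
    truncKernel δ g z = 0 := indicator_of_notMem (by simpa using h) _

theorem truncKernel_of_lt {δ : ℝ} {g : ℝ → ℝ} {z : Plane} (h : ‖z‖ < δ) :
    truncKernel δ g z = g ‖z‖ := indicator_of_mem (by simpa using h) _

theorem truncKernel_neg (δ : ℝ) (g : ℝ → ℝ) (z : Plane) :
    truncKernel δ g (-z) = truncKernel δ g z := by simp [truncKernel]

theorem truncKernel_nonneg {δ σ : ℝ} {g : ℝ → ℝ} (hg : IsKernel δ σ g) (z : Plane) :
    0 ≤ truncKernel δ g z := by
  rcases lt_or_ge ‖z‖ δ with h | h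
  · rw [truncKernel_of_lt h]; exact hg.nonneg _ (norm_nonneg z)
  · rw [truncKernel_of_le h]

/-- In polar coordinates the weight `r ^ (n + 1)` is bounded on `(0, δ)`, where `g` is integrable.
-/
theorem integrable_pow_mul_truncKernel {δ σ : ℝ} {g : ℝ → ℝ} (hg : IsKernel δ σ g) (n : ℕ) :
    Integrable (fun z : Plane => ‖z‖ ^ n * truncKernel δ g z) := by
  have h := integrable_fun_norm_addHaar (volume : Measure Plane)
    (f := fun r => r ^ n * (Iio δ).indicator g r)
  refine h.2 ?_
  have h2 : (fun y : ℝ => y ^ (Module.finrank ℝ Plane - 1) • (y ^ n * (Iio δ).indicator g y)) =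
      (Iio δ).indicator (fun y => y ^ (n + 1) * g y) := by
    ext y
    by_cases hy : y ∈ Iio δ
    · simp only [indicator_of_mem hy, finrank_euclideanSpace, Fintype.card_fin, smul_eq_mul]
      ring
    · simp only [indicator_of_notMem hy]; simp
  rw [h2, IntegrableOn, integrable_indicator_iff measurableSet_Iio, IntegrableOn,
    Measure.restrict_restrict measurableSet_Iio, Iio_inter_Ioi]
  refine Integrable.bdd_mul (c := δ ^ (n + 1)) hg.integrable
    (by fun_prop) ?_
  filter_upwards [ae_restrict_mem measurableSet_Ioo] with y hy
  rw [norm_pow, Real.norm_of_nonneg hy.1.le]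
  exact pow_le_pow_left₀ hy.1.le hy.2.le _

theorem integrable_truncKernel {δ σ : ℝ} {g : ℝ → ℝ} (hg : IsKernel δ σ g) :
    Integrable (truncKernel δ g) := by
  simpa using integrable_pow_mul_truncKernel hg 0

/-- Polar coordinates give `2π ∫ r³ g`, four times the normalised moment. -/
theorem integral_norm_sq_mul_truncKernel {δ σ : ℝ} {g : ℝ → ℝ} (hg : IsKernel δ σ g) :
    ∫ z : Plane, ‖z‖ ^ 2 * truncKernel δ g z = 4 * σ := by
  have h := integral_fun_norm_addHaar (volume : Measure Plane)
    (fun r => r ^ 2 * (Iio δ).indicator g r)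
  have hball : (volume : Measure Plane).real (Metric.ball 0 1) = Real.pi := by
    rw [measureReal_def, EuclideanSpace.volume_ball_fin_two]
    simp [Real.pi_pos.le]
  have h2 : (fun y : ℝ => y ^ (Module.finrank ℝ Plane - 1) • (y ^ 2 * (Iio δ).indicator g y)) =
      (Iio δ).indicator (fun y => y ^ 3 * g y) := by
    ext y
    by_cases hy : y ∈ Iio δ
    · simp only [indicator_of_mem hy, finrank_euclideanSpace, Fintype.card_fin, smul_eq_mul]
      ring
    · simp only [indicator_of_notMem hy]; simp
  refine h.trans ?_
  rw [h2, integral_indicator measurableSet_Iio, Measure.restrict_restrict measurableSet_Iio,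
    Iio_inter_Ioi, hball, finrank_euclideanSpace, Fintype.card_fin]
  have h3 := hg.second_moment
  rw [intervalIntegral.integral_of_le hg.horizon_pos.le, integral_Ioc_eq_integral_Ioo] at h3
  rw [← h3]
  simp only [smul_eq_mul, nsmul_eq_mul]
  push_cast
  ring

theorem integrable_coord_mul_coord_truncKernel {δ σ : ℝ} {g : ℝ → ℝ} (hg : IsKernel δ σ g)
    (i j : Fin 2) : Integrable (fun z : Plane => z i * z j * truncKernel δ g z) := by
  refine (integrable_pow_mul_truncKernel hg 2).mono' ?_ (Filter.Eventually.of_forall fun z => ?_)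
  · exact (Continuous.aestronglyMeasurable (by fun_prop)).mul (integrable_truncKernel hg).1
  · rw [norm_mul, norm_mul, Real.norm_of_nonneg (truncKernel_nonneg hg z), sq]
    have h := fun k => PiLp.norm_apply_le z k
    gcongr
    · exact truncKernel_nonneg hg z
    · exact h i
    · exact h j

/-- Swapping the coordinates equates the diagonal moments, whose sum is `4σ`; reflecting one
coordinate kills the mixed moment. -/
theorem integral_coord_mul_coord_truncKernel {δ σ : ℝ} {g : ℝ → ℝ} (hg : IsKernel δ σ g) :
    ∫ z : Plane, z 0 * z 0 * truncKernel δ g z = 2 * σ ∧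
    ∫ z : Plane, z 1 * z 1 * truncKernel δ g z = 2 * σ ∧
    ∫ z : Plane, z 0 * z 1 * truncKernel δ g z = 0 := by
  have hint := integrable_coord_mul_coord_truncKernel hg
  have hswap : ∫ z : Plane, z 0 * z 0 * truncKernel δ g z =
      ∫ z : Plane, z 1 * z 1 * truncKernel δ g z := by
    let T := LinearIsometryEquiv.piLpCongrLeft 2 ℝ ℝ (Equiv.swap (0 : Fin 2) 1)
    have h := T.measurePreserving.integral_comp T.toHomeomorph.measurableEmbedding
      (fun z : Plane => z 0 * z 0 * truncKernel δ g z)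
    rw [← h]
    refine integral_congr_ae (Filter.Eventually.of_forall fun z => ?_)
    have h0 : T z 0 = z 1 := by
      simp [T, LinearIsometryEquiv.piLpCongrLeft_apply]
    simp only [h0, truncKernel, T.norm_map]
  have hsum : (∫ z : Plane, z 0 * z 0 * truncKernel δ g z) +
      ∫ z : Plane, z 1 * z 1 * truncKernel δ g z = 4 * σ := by
    rw [← integral_norm_sq_mul_truncKernel hg, ← integral_add (hint 0 0) (hint 1 1)]
    refine integral_congr_ae (Filter.Eventually.of_forall fun z => ?_)
    simp only [norm_sq_plane]; ring
  have hodd : ∫ z : Plane, z 0 * z 1 * truncKernel δ g z =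
      -∫ z : Plane, z 0 * z 1 * truncKernel δ g z := by
    let T := LinearIsometryEquiv.piLpCongrRight 2 (fun i : Fin 2 =>
      if i = 0 then LinearIsometryEquiv.neg ℝ (E := ℝ) else LinearIsometryEquiv.refl ℝ ℝ)
    have h := T.measurePreserving.integral_comp T.toHomeomorph.measurableEmbedding
      (fun z : Plane => z 0 * z 1 * truncKernel δ g z)
    rw [← integral_neg]
    refine h.symm.trans ?_
    refine integral_congr_ae (Filter.Eventually.of_forall fun z => ?_)
    have h0 : T z 0 = - z 0 := by simp [T]
    have h1 : T z 1 = z 1 := by simp [T]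
    simp only [h0, h1, truncKernel, T.norm_map]
    ring
  exact ⟨by linarith, by linarith, by linarith⟩

theorem integral_bilin_truncKernel {δ σ : ℝ} {g : ℝ → ℝ} (hg : IsKernel δ σ g)
    (a b c d : ℝ) :
    Integrable (fun z : Plane => (a * (z 0 * z 0) + b * (z 0 * z 1) + c * (z 1 * z 0) +
      d * (z 1 * z 1)) * truncKernel δ g z) ∧
    ∫ z : Plane, (a * (z 0 * z 0) + b * (z 0 * z 1) + c * (z 1 * z 0) + d * (z 1 * z 1)) *
      truncKernel δ g z = 2 * σ * (a + d) := by
  obtain ⟨h00, h11, h01⟩ := integral_coord_mul_coord_truncKernel hg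
  have hint := integrable_coord_mul_coord_truncKernel hg
  have heq : (fun z : Plane => (a * (z 0 * z 0) + b * (z 0 * z 1) + c * (z 1 * z 0) +
      d * (z 1 * z 1)) * truncKernel δ g z) = fun z : Plane =>
      a * (z 0 * z 0 * truncKernel δ g z) + (b + c) * (z 0 * z 1 * truncKernel δ g z) +
      d * (z 1 * z 1 * truncKernel δ g z) := by
    ext z; ring
  have i1 := (hint 0 0).const_mul a
  have i2 := (hint 0 1).const_mul (b + c)
  have i3 := (hint 1 1).const_mul d
  rw [heq]
  refine ⟨(i1.add i2).add i3, ?_⟩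
  have h12 := integral_add i1 i2
  refine (integral_add (i1.add i2) i3).trans ?_
  simp only [Pi.add_apply]
  rw [h12, integral_const_mul, integral_const_mul, integral_const_mul, h00, h11, h01]
  ring

/-! ### Integrals over the set of exiting points -/

/-- Translation by `z` matches the points of `Ω` that stay in `Ω`, so their contributions cancel and
only the strips along the boundary survive. -/
theorem setIntegral_sub_setIntegral_translate {Ω : Set Plane} (hΩ : IsOpen Ω) {ψ : Plane → ℝ}
    (hψ : Integrable ψ) (z : Plane) :
    (∫ x in Ω, ψ x) - ∫ x in Ω, ψ (x - z) =
      (∫ x in exitSet Ω z, ψ x) - ∫ x in exitSet Ω (-z), ψ (x - z) := by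
  have hm : ∀ z : Plane, MeasurableSet ((· + z) ⁻¹' Ω) := fun z =>
    (measurable_id.add_const z) hΩ.measurableSet
  have hψ' : Integrable fun x => ψ (x - z) := hψ.comp_sub_right z
  have h1 := integral_inter_add_sdiff (s := Ω) (hm z) hψ.integrableOn
  have h2 := integral_inter_add_sdiff (s := Ω) (hm (-z)) hψ'.integrableOn
  have h3 : ∫ x in Ω ∩ (· + -z) ⁻¹' Ω, ψ (x - z) = ∫ x in Ω ∩ (· + z) ⁻¹' Ω, ψ x := by
    rw [← (measurePreserving_sub_right volume z).setIntegral_preimage_emb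
      (MeasurableEquiv.subRight z).measurableEmbedding ψ]
    congr 2
    ext x
    simp [sub_eq_add_neg, and_comm]
  rw [h3] at h2
  have e1 : Ω \ (· + z) ⁻¹' Ω = exitSet Ω z := rfl
  have e2 : Ω \ (· + -z) ⁻¹' Ω = exitSet Ω (-z) := rfl
  rw [e1] at h1
  rw [e2] at h2
  linarith

section Boundary

variable {Ω : Set Plane} {Γ : ℝ → Plane} {L : ℝ}

theorem continuous_inner_outwardNormal_mul (hΩ : IsOpen Ω) (hc : Convex ℝ Ω)
    (hΓ : IsClosedC2Curve Γ L (frontier Ω)) {p : Plane} (hp : p ∈ Ω) (z : Plane) :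
    Continuous fun η => inner ℝ z (outwardNormal Ω Γ η) * ‖deriv Γ η‖ := by
  obtain ⟨ε, hε⟩ := exists_outwardNormal_sign hΩ hc hΓ hp
  have h1 : ∀ η, inner ℝ z (outwardNormal Ω Γ η) * ‖deriv Γ η‖ = ε * cross z (deriv Γ η) := by
    intro η
    rw [(hε η).2.2, inner_smul_right, mul_assoc, inner_curveNormal_mul (hΓ.regular η)]
  simp only [h1]
  have h2 : Continuous (deriv Γ) := hΓ.contDiff.continuous_deriv (by norm_num)
  unfold cross
  fun_prop

/-- Let `B` be the boundary integral. By the divergence theorem, `s ↦ ∫_Ω ψ(x - s z) dx + s B` has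
as derivative the boundary integral of `(ψ(Γ) - ψ(Γ - s z)) ⟪z, n⟫`, which the Lipschitz bound makes
quadratic in `z`. The mean value inequality on `[0, 1]` concludes. -/
theorem abs_setIntegral_sub_translate_sub_boundary_le (hΩ : IsOpen Ω) (hc : Convex ℝ Ω)
    (hb : Bornology.IsBounded Ω) (hΓ : IsClosedC2Curve Γ L (frontier Ω)) {p : Plane} (hp : p ∈ Ω)
    {ψ : Plane → ℝ} (hψ : ContDiff ℝ 1 ψ) {K : ℝ} (hK : 0 ≤ K)
    (hlip : ∀ x y, |ψ x - ψ y| ≤ K * ‖x - y‖) (z : Plane) :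
    |(∫ x in Ω, ψ x) - (∫ x in Ω, ψ (x - z)) -
      ∫ η in (0 : ℝ)..L, ψ (Γ η) * (inner ℝ z (outwardNormal Ω Γ η) * ‖deriv Γ η‖)| ≤
      K * ‖z‖ ^ 2 * ∫ η in (0 : ℝ)..L, ‖deriv Γ η‖ := by
  set w := fun η => inner ℝ z (outwardNormal Ω Γ η) * ‖deriv Γ η‖
  have hw : Continuous w := continuous_inner_outwardNormal_mul hΩ hc hΓ hp z
  have hwle : ∀ η, |w η| ≤ ‖z‖ * ‖deriv Γ η‖ := by
    intro η
    rw [abs_mul, abs_norm]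
    gcongr
    refine (abs_real_inner_le_norm _ _).trans ?_
    rw [norm_outwardNormal Ω (hΓ.regular η), mul_one]
  have hΓc : Continuous Γ := hΓ.contDiff.continuous
  have hdΓ : Continuous (deriv Γ) := hΓ.contDiff.continuous_deriv (by norm_num)
  have hψd : Differentiable ℝ ψ := hψ.differentiable one_ne_zero
  have hbound : ∀ x, ‖fderiv ℝ ψ x‖ ≤ K := by
    intro x
    have : LipschitzWith K.toNNReal ψ := LipschitzWith.of_dist_le' fun x y => by
      rw [Real.dist_eq, dist_eq_norm]; exact hlip x y
    simpa [hK] using norm_fderiv_le_of_lipschitz ℝ this (x₀ := x)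
  have hfin : IsFiniteMeasure (volume.restrict Ω) := ⟨by simpa using hb.measure_lt_top⟩
  have hψbd : ∃ c, ∀ x ∈ Ω, ∀ s ∈ Icc (-1 : ℝ) 2, |ψ (x - s • z)| ≤ c := by
    obtain ⟨R, hR⟩ := hb.subset_closedBall p
    refine ⟨|ψ p| + K * (R + 2 * ‖z‖), fun x hx s hs => ?_⟩
    have h1 := hlip (x - s • z) p
    have h2 : ‖x - s • z - p‖ ≤ R + 2 * ‖z‖ := by
      have h3 : ‖x - p‖ ≤ R := by simpa [dist_eq_norm] using hR hx
      calc ‖x - s • z - p‖ = ‖(x - p) - s • z‖ := by congr 1; abel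
        _ ≤ ‖x - p‖ + ‖s • z‖ := norm_sub_le _ _
        _ ≤ R + 2 * ‖z‖ := by
          rw [norm_smul, Real.norm_eq_abs]
          have : |s| ≤ 2 := abs_le.2 ⟨by linarith [hs.1], hs.2⟩
          gcongr
    have h4 := abs_sub_abs_le_abs_sub (ψ (x - s • z)) (ψ p)
    nlinarith [mul_le_mul_of_nonneg_left h2 hK]
  obtain ⟨c, hcψ⟩ := hψbd
  set B := ∫ η in (0 : ℝ)..L, ψ (Γ η) * w η
  have hderiv : ∀ s ∈ Icc (0 : ℝ) 1, HasDerivAt (fun s => ∫ x in Ω, ψ (x - s • z))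
      (∫ x in Ω, fderiv ℝ ψ (x - s • z) (-z)) s := by
    intro s hs
    -- An open interval around `[0, 1]` gives two-sided derivatives at both endpoints.
    refine (hasDerivAt_integral_of_dominated_loc_of_deriv_le (s := Ioo (-1 : ℝ) 2)
      (F := fun s x => ψ (x - s • z)) (F' := fun s x => fderiv ℝ ψ (x - s • z) (-z))
      (bound := fun _ => K * ‖z‖) (Ioo_mem_nhds (by linarith [hs.1]) (by linarith [hs.2]))
      ?_ ?_ ?_ ?_ ?_ ?_).2
    · exact Filter.Eventually.of_forall fun s =>
        (hψ.continuous.comp (by fun_prop)).aestronglyMeasurable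
    · refine Integrable.of_bound (C := c)
        (hψ.continuous.comp (by fun_prop)).aestronglyMeasurable ?_
      filter_upwards [ae_restrict_mem hΩ.measurableSet] with x hx
      exact hcψ x hx s ⟨by linarith [hs.1], by linarith [hs.2]⟩
    · exact (((hψ.continuous_fderiv one_ne_zero).comp (by fun_prop)).clm_apply
        continuous_const).aestronglyMeasurable
    · refine Filter.Eventually.of_forall fun x t _ => ?_
      refine (ContinuousLinearMap.le_opNorm _ _).trans ?_
      rw [norm_neg]
      gcongr
      exact hbound _
    · exact integrable_const _
    · refine Filter.Eventually.of_forall fun x t _ => ?_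
      have h1 : HasDerivAt (fun t : ℝ => x - t • z) (-z) t := by
        simpa using ((hasDerivAt_id t).smul_const z).const_sub x
      exact (hψd _).hasFDerivAt.comp_hasDerivAt t h1
  have hdiv : ∀ s : ℝ, ∫ x in Ω, fderiv ℝ ψ (x - s • z) (-z) =
      -∫ η in (0 : ℝ)..L, ψ (Γ η - s • z) * w η := by
    intro s
    have hf : ContDiff ℝ 1 fun x => ψ (x - s • z) :=
      hψ.comp (contDiff_id.sub contDiff_const)
    rw [← setIntegral_fderiv_eq_boundary hΩ hc hb hΓ hp hf z, ← integral_neg]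
    refine integral_congr_ae (Filter.Eventually.of_forall fun x => ?_)
    simp only [fderiv_comp_sub, map_neg]
  have hk : ∀ s ∈ Icc (0 : ℝ) 1, HasDerivWithinAt (fun s => (∫ x in Ω, ψ (x - s • z)) + s * B)
      ((∫ x in Ω, fderiv ℝ ψ (x - s • z) (-z)) + B) (Icc 0 1) s := by
    intro s hs
    have := (hderiv s hs).add ((hasDerivAt_id s).mul_const B)
    rw [one_mul] at this
    exact this.hasDerivWithinAt
  have hle := norm_image_sub_le_of_norm_deriv_le_segment_01' hk
    (C := K * ‖z‖ ^ 2 * ∫ η in (0 : ℝ)..L, ‖deriv Γ η‖) (fun s hs => by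
      rw [hdiv, neg_add_eq_sub, ← intervalIntegral.integral_sub
        (Continuous.intervalIntegrable (by fun_prop) _ _)
        (Continuous.intervalIntegrable (by fun_prop) _ _),
        ← intervalIntegral.integral_const_mul]
      refine intervalIntegral.norm_integral_le_of_norm_le hΓ.period_pos.le
        (Filter.Eventually.of_forall fun η _ => ?_)
        (Continuous.intervalIntegrable (by fun_prop) _ _)
      rw [← sub_mul, norm_mul, Real.norm_eq_abs, Real.norm_eq_abs]
      have h1 : |ψ (Γ η) - ψ (Γ η - s • z)| ≤ K * ‖z‖ := by
        refine (hlip _ _).trans ?_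
        gcongr
        rw [sub_sub_cancel, norm_smul, Real.norm_of_nonneg hs.1]
        exact mul_le_of_le_one_left (norm_nonneg z) hs.2.le
      calc _ ≤ (K * ‖z‖) * (‖z‖ * ‖deriv Γ η‖) := by gcongr; exact hwle η
        _ = _ := by ring)
  simp only [one_smul, zero_smul, sub_zero, one_mul, zero_mul, add_zero] at hle
  rw [Real.norm_eq_abs, abs_sub_comm] at hle
  rwa [sub_sub]

/-- The function `ψ = Ψ · z` has Lipschitz constant `M ‖z‖`, so the quadratic error for `ψ` becomes
cubic. Replacing `ψ(x - z)` by `ψ(x)` on the exit set of `-z` costs `M ‖z‖²` on an area of at most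
`C ‖z‖`. -/
theorem abs_exit_add_exit_sub_boundary_le (hΩ : IsOpen Ω) (hc : Convex ℝ Ω)
    (hb : Bornology.IsBounded Ω) (hΓ : IsClosedC2Curve Γ L (frontier Ω)) {p : Plane} (hp : p ∈ Ω)
    {Ψ : Plane → Plane →L[ℝ] ℝ} (hΨ : ContDiff ℝ 1 Ψ) (hΨc : HasCompactSupport Ψ) {M : ℝ}
    (hM : 0 ≤ M) (hlip : ∀ x y, ‖Ψ x - Ψ y‖ ≤ M * ‖x - y‖) {C : ℝ}
    (hC : ∀ z, volume.real (exitSet Ω z) ≤ C * ‖z‖) (z : Plane) :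
    |(∫ x in exitSet Ω z, Ψ x z) + (∫ x in exitSet Ω (-z), Ψ x (-z)) -
      ∫ η in (0 : ℝ)..L, Ψ (Γ η) z * (inner ℝ z (outwardNormal Ω Γ η) * ‖deriv Γ η‖)| ≤
      M * ((∫ η in (0 : ℝ)..L, ‖deriv Γ η‖) + C) * ‖z‖ ^ 3 := by
  have hψ : ContDiff ℝ 1 fun x => Ψ x z := hΨ.clm_apply contDiff_const
  have hψlip : ∀ x y, |Ψ x z - Ψ y z| ≤ M * ‖z‖ * ‖x - y‖ := by
    intro x y
    rw [← sub_apply]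
    refine ((Ψ x - Ψ y).le_opNorm z).trans ?_
    calc _ ≤ M * ‖x - y‖ * ‖z‖ := by gcongr; exact hlip x y
      _ = _ := by ring
  have hψc : HasCompactSupport fun x => Ψ x z :=
    hΨc.comp_left (g := fun T : Plane →L[ℝ] ℝ => T z) (by simp)
  have hψi : Integrable fun x => Ψ x z := hψ.continuous.integrable_of_hasCompactSupport hψc
  have h1 := abs_setIntegral_sub_translate_sub_boundary_le hΩ hc hb hΓ hp hψ
    (mul_nonneg hM (norm_nonneg z)) hψlip z
  rw [setIntegral_sub_setIntegral_translate hΩ hψi] at h1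
  have hfin : volume (exitSet Ω (-z)) < ⊤ := (hb.subset (fun x hx => hx.1)).measure_lt_top
  have h2 : |(∫ x in exitSet Ω (-z), Ψ (x - z) z) - ∫ x in exitSet Ω (-z), Ψ x z| ≤
      M * ‖z‖ * ‖z‖ * (C * ‖z‖) := by
    rw [← integral_sub (hψi.comp_sub_right z).integrableOn hψi.integrableOn]
    have h3 : ∀ x ∈ exitSet Ω (-z), ‖Ψ (x - z) z - Ψ x z‖ ≤ M * ‖z‖ * ‖z‖ := fun x _ => by
      rw [Real.norm_eq_abs]
      refine (hψlip _ _).trans (le_of_eq ?_)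
      rw [sub_sub_cancel_left, norm_neg]
    refine (norm_setIntegral_le_of_norm_le_const hfin h3).trans ?_
    gcongr
    simpa using hC (-z)
  simp only [map_neg, integral_neg]
  calc _ ≤ _ := abs_sub_le _ ((∫ x in exitSet Ω z, Ψ x z) -
          ∫ x in exitSet Ω (-z), Ψ (x - z) z) _
    _ ≤ M * ‖z‖ * ‖z‖ * (C * ‖z‖) + M * ‖z‖ * ‖z‖ ^ 2 * ∫ η in (0 : ℝ)..L, ‖deriv Γ η‖ := by
        refine add_le_add (le_trans (le_of_eq ?_) h2) h1
        congr 1; ring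
    _ = _ := by ring

end Boundary

/-! ### Double integrals against a translation invariant kernel -/

theorem measurableSet_inter_translate {A B : Set Plane} (hA : MeasurableSet A)
    (hB : MeasurableSet B) (z : Plane) : MeasurableSet {x | x ∈ A ∧ x + z ∈ B} :=
  hA.inter ((measurable_id.add_const z) hB)

theorem integrableOn_prod_kernel {A B : Set Plane} (hA : MeasurableSet A)
    (hfin : volume A ≠ ⊤) {k : Plane × Plane → ℝ} (hk : Continuous k) {c : ℝ}
    (hc : ∀ q, |k q| ≤ c) {G : Plane → ℝ} (hG : Integrable G) :
    IntegrableOn (fun q : Plane × Plane => k q * G (q.2 - q.1)) (A ×ˢ B)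
      (volume.prod volume) := by
  have hA1 : Integrable (A.indicator fun _ => (1 : ℝ)) :=
    (integrable_indicator_iff hA).2 (integrableOn_const hfin)
  have h1 : Integrable (fun q : Plane × Plane => A.indicator (fun _ => (1 : ℝ)) q.1 *
      G (q.2 - q.1)) (volume.prod volume) := by
    rw [← (measurePreserving_prod_add (volume : Measure Plane)
      (volume : Measure Plane)).integrable_comp_emb
      (MeasurableEquiv.shearAddRight Plane).measurableEmbedding]
    refine (hA1.mul_prod hG).congr (Filter.Eventually.of_forall fun q => ?_)
    simp [Function.comp]
  have h2 : IntegrableOn (fun q : Plane × Plane => G (q.2 - q.1)) (A ×ˢ univ)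
      (volume.prod volume) := by
    rw [← integrable_indicator_iff (hA.prod MeasurableSet.univ)]
    refine h1.congr (Filter.Eventually.of_forall fun q => ?_)
    by_cases hq : q.1 ∈ A
    · simp only [indicator_of_mem hq, one_mul]
      rw [indicator_of_mem (show q ∈ A ×ˢ univ from ⟨hq, trivial⟩)]
    · simp only [indicator_of_notMem hq, zero_mul]
      rw [indicator_of_notMem (show q ∉ A ×ˢ univ from fun h => hq h.1)]
  refine Integrable.bdd_mul (c := c) (h2.mono_set (prod_mono_right (subset_univ B)))
    hk.aestronglyMeasurable (Filter.Eventually.of_forall hc)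

/-- Fubini in the sheared coordinates `(x, z) = (x, y - x)`; for `A = Ω` and `B = Ωᶜ` the slice at
`z` is `exitSet Ω z`. -/
theorem setIntegral_prod_kernel {A B : Set Plane} (hA : MeasurableSet A) (hB : MeasurableSet B)
    (hfin : volume A ≠ ⊤) {k : Plane × Plane → ℝ} (hk : Continuous k) {c : ℝ}
    (hc : ∀ q, |k q| ≤ c) {G : Plane → ℝ} (hG : Integrable G) :
    Integrable (fun z => (∫ x in {x | x ∈ A ∧ x + z ∈ B}, k (x, x + z)) * G z) ∧
    ∫ q in A ×ˢ B, k q * G (q.2 - q.1) ∂(volume.prod volume) =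
      ∫ z, (∫ x in {x | x ∈ A ∧ x + z ∈ B}, k (x, x + z)) * G z := by
  set e := MeasurableEquiv.shearAddRight Plane
  have he : MeasurePreserving e (volume.prod volume) (volume.prod volume) :=
    measurePreserving_prod_add (volume : Measure Plane) (volume : Measure Plane)
  set f : Plane × Plane → ℝ := fun q => k q * G (q.2 - q.1)
  have hf := integrableOn_prod_kernel (B := B) hA hfin hk hc hG
  have hAB := hA.prod hB
  set F : Plane × Plane → ℝ := fun p => (A ×ˢ B).indicator f (e p)
  have hF : Integrable F (volume.prod volume) :=
    (he.integrable_comp_emb e.measurableEmbedding).2 ((integrable_indicator_iff hAB).2 hf)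
  have hint : ∫ p, F p ∂(volume.prod volume) = ∫ q in A ×ˢ B, f q ∂(volume.prod volume) := by
    rw [← integral_indicator hAB]
    exact he.integral_comp e.measurableEmbedding ((A ×ˢ B).indicator f)
  have hslice : ∀ z, ∫ x, F (x, z) = (∫ x in {x | x ∈ A ∧ x + z ∈ B}, k (x, x + z)) * G z := by
    intro z
    rw [← integral_mul_const, ← integral_indicator (measurableSet_inter_translate hA hB z)]
    refine integral_congr_ae (Filter.Eventually.of_forall fun x => ?_)
    have hex : e (x, z) = (x, x + z) := rfl
    simp only [F, hex]
    by_cases h : x ∈ A ∧ x + z ∈ B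
    · rw [indicator_of_mem (show (x, x + z) ∈ A ×ˢ B from h),
        indicator_of_mem (show x ∈ {x | x ∈ A ∧ x + z ∈ B} from h)]
      simp [f]
    · rw [indicator_of_notMem (show (x, x + z) ∉ A ×ˢ B from h),
        indicator_of_notMem (show x ∉ {x | x ∈ A ∧ x + z ∈ B} from h)]
  simp only [← hslice]
  exact ⟨hF.integral_prod_right, by rw [← hint, integral_prod_symm F hF]⟩

/-- The double integral of `(u x - u y) v x` over a square is of second order, by antisymmetry. -/
theorem abs_setIntegral_square_le {δ σ : ℝ} {g : ℝ → ℝ} (hg : IsKernel δ σ g) {A : Set Plane}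
    (hA : MeasurableSet A) (hfin : volume A ≠ ⊤) {u v : Plane → ℝ} (hu : Continuous u)
    (hv : Continuous v) {a b : ℝ} (ha : ∀ x, |u x| ≤ a) (hb : ∀ x, |v x| ≤ b) {M : ℝ}
    (hM0 : 0 ≤ M) (hM : ∀ x y, |(u x - u y) * (v x - v y)| ≤ M * ‖x - y‖ ^ 2) :
    |∫ q in A ×ˢ A, (u q.1 - u q.2) * v q.1 * truncKernel δ g (q.2 - q.1)
      ∂(volume.prod volume)| ≤ 2 * M * σ * volume.real A := by
  have hk : Continuous fun q : Plane × Plane => (u q.1 - u q.2) * v q.1 := by fun_prop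
  have hkb : ∀ q : Plane × Plane, |(u q.1 - u q.2) * v q.1| ≤ (a + a) * b := by
    intro q
    rw [abs_mul]
    have h1 : |u q.1 - u q.2| ≤ a + a := (abs_sub _ _).trans (add_le_add (ha _) (ha _))
    exact mul_le_mul h1 (hb _) (abs_nonneg _) ((abs_nonneg _).trans h1)
  have hi := integrableOn_prod_kernel (B := A) hA hfin hk hkb (integrable_truncKernel hg)
  set f : Plane × Plane → ℝ := fun q => (u q.1 - u q.2) * v q.1 * truncKernel δ g (q.2 - q.1)
  have hpre : Prod.swap ⁻¹' (A ×ˢ A) = A ×ˢ A := preimage_swap_prod A A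
  have hs : MeasurePreserving (Prod.swap : Plane × Plane → Plane × Plane)
    (volume.prod volume) (volume.prod volume) := Measure.measurePreserving_swap
  have hswap : ∫ q in A ×ˢ A, f q.swap ∂(volume.prod volume) =
      ∫ q in A ×ˢ A, f q ∂(volume.prod volume) := by
    have := hs.setIntegral_preimage_emb MeasurableEquiv.prodComm.measurableEmbedding f (A ×ˢ A)
    rwa [hpre] at this
  have hi' : IntegrableOn (fun q => f q.swap) (A ×ˢ A) (volume.prod volume) := by
    have := (hs.integrableOn_comp_preimage MeasurableEquiv.prodComm.measurableEmbedding
      (f := f) (s := A ×ˢ A)).2 hi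
    rwa [hpre] at this
  have hG2 := integrable_pow_mul_truncKernel hg 2
  have hone := setIntegral_prod_kernel hA hA hfin
    (k := fun _ => (1 : ℝ)) continuous_const (c := 1) (by simp) hG2
  have hionei := integrableOn_prod_kernel (B := A) hA hfin
    (k := fun _ => (1 : ℝ)) continuous_const (c := 1) (by simp) hG2
  simp only [one_mul] at hone hionei
  have hsq : ∫ q in A ×ˢ A, ‖q.2 - q.1‖ ^ 2 * truncKernel δ g (q.2 - q.1)
      ∂(volume.prod volume) ≤ volume.real A * (4 * σ) := by
    rw [hone.2, ← integral_norm_sq_mul_truncKernel hg, ← integral_const_mul]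
    refine integral_mono hone.1 (hG2.const_mul _) fun z => ?_
    refine mul_le_mul_of_nonneg_right ?_ (mul_nonneg (sq_nonneg _) (truncKernel_nonneg hg z))
    rw [setIntegral_const, smul_eq_mul, mul_one]
    exact measureReal_mono (fun x hx => hx.1) hfin
  have h2 : |∫ q in A ×ˢ A, (f q + f q.swap) ∂(volume.prod volume)| ≤
      M * (volume.real A * (4 * σ)) := by
    refine le_trans ?_ (mul_le_mul_of_nonneg_left hsq hM0)
    rw [← integral_const_mul, ← Real.norm_eq_abs]
    refine norm_integral_le_of_norm_le (hionei.const_mul M)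
      (Filter.Eventually.of_forall fun q => ?_)
    -- Exchanging `x` and `y` changes the sign of the jump of `u`, so the sum also contains an
    -- increment of `v`.
    have h3 : f q + f q.swap =
        (u q.1 - u q.2) * (v q.1 - v q.2) * truncKernel δ g (q.2 - q.1) := by
      have : truncKernel δ g (q.1 - q.2) = truncKernel δ g (q.2 - q.1) := by
        rw [← truncKernel_neg, neg_sub]
      simp only [f, Prod.fst_swap, Prod.snd_swap, this]
      ring
    rw [h3, norm_mul, Real.norm_of_nonneg (truncKernel_nonneg hg _), ← mul_assoc]
    refine mul_le_mul_of_nonneg_right ?_ (truncKernel_nonneg hg _)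
    rw [norm_sub_rev]
    exact hM _ _
  rw [integral_add hi hi', hswap, ← two_mul, abs_mul, abs_two] at h2
  linarith

/-! ### The limit of the double integral across the boundary -/

/-- The boundary integral is a quadratic form in `z` with coefficients `∫ Ψ(eᵢ) nⱼ ds`. The
isotropic second moments retain `2σ` times its trace, which is `∫ Ψ(n) ds`. -/
theorem integral_boundary_form {Ω : Set Plane} (hΩ : IsOpen Ω) (hc : Convex ℝ Ω)
    {Γ : ℝ → Plane} {L : ℝ} (hΓ : IsClosedC2Curve Γ L (frontier Ω)) {p : Plane} (hp : p ∈ Ω)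
    {Ψ : Plane → Plane →L[ℝ] ℝ} (hΨ : Continuous Ψ) {δ σ : ℝ} {g : ℝ → ℝ}
    (hg : IsKernel δ σ g) :
    Integrable (fun z : Plane => (∫ η in (0 : ℝ)..L,
      Ψ (Γ η) z * (inner ℝ z (outwardNormal Ω Γ η) * ‖deriv Γ η‖)) * truncKernel δ g z) ∧
    ∫ z : Plane, (∫ η in (0 : ℝ)..L,
      Ψ (Γ η) z * (inner ℝ z (outwardNormal Ω Γ η) * ‖deriv Γ η‖)) * truncKernel δ g z =
    2 * σ * ∫ η in (0 : ℝ)..L, Ψ (Γ η) (outwardNormal Ω Γ η) * ‖deriv Γ η‖ := by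
  set n := outwardNormal Ω Γ
  have hn : ∀ i, Continuous fun η => n η i * ‖deriv Γ η‖ := by
    intro i
    have := continuous_inner_outwardNormal_mul hΩ hc hΓ hp (EuclideanSpace.single i (1 : ℝ))
    simpa [EuclideanSpace.inner_single_left] using this
  have hΓc : Continuous Γ := hΓ.contDiff.continuous
  have hΨe : ∀ i, Continuous fun η => Ψ (Γ η) (EuclideanSpace.single i (1 : ℝ)) := fun i =>
    (hΨ.comp hΓc).clm_apply continuous_const
  set m : Fin 2 → Fin 2 → ℝ → ℝ := fun i j η =>
    Ψ (Γ η) (EuclideanSpace.single i (1 : ℝ)) * (n η j * ‖deriv Γ η‖)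
  have hm : ∀ i j, IntervalIntegrable (m i j) volume 0 L := fun i j =>
    ((hΨe i).mul (hn j)).intervalIntegrable _ _
  have hform : ∀ z : Plane, ∫ η in (0 : ℝ)..L, Ψ (Γ η) z * (inner ℝ z (n η) * ‖deriv Γ η‖) =
      (∫ η in (0 : ℝ)..L, m 0 0 η) * (z 0 * z 0) + (∫ η in (0 : ℝ)..L, m 0 1 η) * (z 0 * z 1) +
      (∫ η in (0 : ℝ)..L, m 1 0 η) * (z 1 * z 0) +
      (∫ η in (0 : ℝ)..L, m 1 1 η) * (z 1 * z 1) := by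
    intro z
    simp only [← intervalIntegral.integral_mul_const]
    rw [← intervalIntegral.integral_add ((hm 0 0).mul_const _) ((hm 0 1).mul_const _),
      ← intervalIntegral.integral_add (((hm 0 0).mul_const _).add ((hm 0 1).mul_const _))
        ((hm 1 0).mul_const _),
      ← intervalIntegral.integral_add ((((hm 0 0).mul_const _).add ((hm 0 1).mul_const _)).add
        ((hm 1 0).mul_const _)) ((hm 1 1).mul_const _)]
    refine intervalIntegral.integral_congr fun η _ => ?_
    have hin : inner ℝ z (n η) = z 0 * n η 0 + z 1 * n η 1 := by
      rw [PiLp.inner_apply, Fin.sum_univ_two]; simp [mul_comm]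
    simp only [hin, m, continuousLinearMap_plane (Ψ (Γ η)) z]
    ring
  simp only [hform]
  obtain ⟨h1, h2⟩ := integral_bilin_truncKernel hg (∫ η in (0 : ℝ)..L, m 0 0 η)
    (∫ η in (0 : ℝ)..L, m 0 1 η) (∫ η in (0 : ℝ)..L, m 1 0 η) (∫ η in (0 : ℝ)..L, m 1 1 η)
  refine ⟨h1, h2.trans ?_⟩
  rw [← intervalIntegral.integral_add (hm 0 0) (hm 1 1)]
  congr 1
  refine intervalIntegral.integral_congr fun η _ => ?_
  simp only [m, continuousLinearMap_plane (Ψ (Γ η)) (n η)]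
  ring

/-- A single exit integral `J z` is not close to a quadratic form in `z`, but `J z + J (-z)` is, up
to `D ‖z‖³`; evenness of the kernel permits this symmetrisation. The constant depends on neither the
kernel nor its horizon. -/
theorem exists_abs_setIntegral_sub_boundary_le {Ω : Set Plane} (hΩ : IsOpen Ω) (hc : Convex ℝ Ω)
    (hb : Bornology.IsBounded Ω) {Γ : ℝ → Plane} {L : ℝ}
    (hΓ : IsClosedC2Curve Γ L (frontier Ω)) {p : Plane} (hp : p ∈ Ω)
    {Ψ : Plane → Plane →L[ℝ] ℝ} (hΨ : ContDiff ℝ 1 Ψ) (hΨc : HasCompactSupport Ψ)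
    {k : Plane × Plane → ℝ} (hk : Continuous k) {c : ℝ} (hkb : ∀ q, |k q| ≤ c) {N : ℝ}
    (hN : 0 ≤ N) (hkΨ : ∀ x z, |k (x, x + z) - Ψ x z| ≤ N * ‖z‖ ^ 2) :
    ∃ C : ℝ, ∀ δ σ : ℝ, ∀ g : ℝ → ℝ, IsKernel δ σ g →
      |(∫ q in Ω ×ˢ Ωᶜ, k q * truncKernel δ g (q.2 - q.1) ∂(volume.prod volume)) -
        σ * ∫ η in (0 : ℝ)..L, Ψ (Γ η) (outwardNormal Ω Γ η) * ‖deriv Γ η‖| ≤ C * σ * δ := by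
  obtain ⟨M, hM⟩ := hΨ.lipschitzWith_of_hasCompactSupport hΨc one_ne_zero
  have hlip : ∀ x y, ‖Ψ x - Ψ y‖ ≤ (M : ℝ) * ‖x - y‖ := fun x y => hM.norm_sub_le x y
  obtain ⟨E, hE0, hE⟩ := exists_measureReal_exitSet_le hΩ hc hb
  set D := 2 * (N * E) + M * ((∫ η in (0 : ℝ)..L, ‖deriv Γ η‖) + E)
  have hlen : 0 ≤ ∫ η in (0 : ℝ)..L, ‖deriv Γ η‖ :=
    intervalIntegral.integral_nonneg hΓ.period_pos.le fun _ _ => norm_nonneg _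
  have hD : 0 ≤ D := by positivity
  refine ⟨2 * D, fun δ σ g hg => ?_⟩
  have hfin : volume Ω ≠ ⊤ := hb.measure_lt_top.ne
  obtain ⟨hJi, hJ⟩ := setIntegral_prod_kernel hΩ.measurableSet hΩ.measurableSet.compl hfin hk hkb
    (integrable_truncKernel hg)
  obtain ⟨hQi, hQ⟩ := integral_boundary_form hΩ hc hΓ hp hΨ.continuous hg
  set J : Plane → ℝ := fun z => ∫ x in exitSet Ω z, k (x, x + z)
  set Q : Plane → ℝ := fun z => ∫ η in (0 : ℝ)..L,
    Ψ (Γ η) z * (inner ℝ z (outwardNormal Ω Γ η) * ‖deriv Γ η‖)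
  change Integrable fun z => J z * truncKernel δ g z at hJi
  change _ = ∫ z, J z * truncKernel δ g z at hJ
  have hJi' : Integrable fun z => J (-z) * truncKernel δ g z := by
    simpa only [truncKernel_neg] using hJi.comp_neg
  have hJ' : ∫ z, J (-z) * truncKernel δ g z = ∫ z, J z * truncKernel δ g z := by
    rw [← integral_neg_eq_self]
    simp only [neg_neg, truncKernel_neg]
  have hJΨ : ∀ z, |J z - ∫ x in exitSet Ω z, Ψ x z| ≤ N * E * ‖z‖ ^ 3 := by
    intro z
    have hlt : volume (exitSet Ω z) < ⊤ := (hb.subset (fun x hx => hx.1)).measure_lt_top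
    have : IsFiniteMeasure (volume.restrict (exitSet Ω z)) := ⟨by simpa using hlt⟩
    have hΨi : Integrable (fun x => Ψ x z) :=
      (hΨ.continuous.clm_apply continuous_const).integrable_of_hasCompactSupport
        (hΨc.comp_left (g := fun T : Plane →L[ℝ] ℝ => T z) (by simp))
    have hki : IntegrableOn (fun x => k (x, x + z)) (exitSet Ω z) :=
      Integrable.of_bound (C := c) (hk.comp (by fun_prop)).aestronglyMeasurable
        (Filter.Eventually.of_forall fun x => hkb _)
    simp only [J]
    rw [← integral_sub hki hΨi.integrableOn, ← Real.norm_eq_abs]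
    have hle : ∀ x ∈ exitSet Ω z, ‖k (x, x + z) - Ψ x z‖ ≤ N * ‖z‖ ^ 2 := fun x _ => hkΨ x z
    refine (norm_setIntegral_le_of_norm_le_const hlt hle).trans ?_
    calc _ ≤ N * ‖z‖ ^ 2 * (E * ‖z‖) := by gcongr; exact hE z
      _ = _ := by ring
  have hpt : ∀ z, |J z + J (-z) - Q z| ≤ D * ‖z‖ ^ 3 := by
    intro z
    have h1 := abs_exit_add_exit_sub_boundary_le hΩ hc hb hΓ hp hΨ hΨc M.coe_nonneg hlip hE z
    have h2 := hJΨ z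
    have h3 := hJΨ (-z)
    rw [norm_neg] at h3
    have h4 : J z + J (-z) - Q z = (J z - ∫ x in exitSet Ω z, Ψ x z) +
      (J (-z) - ∫ x in exitSet Ω (-z), Ψ x (-z)) +
      ((∫ x in exitSet Ω z, Ψ x z) + (∫ x in exitSet Ω (-z), Ψ x (-z)) - Q z) := by ring
    rw [h4]
    refine (abs_add_three _ _ _).trans ((add_le_add (add_le_add h2 h3) h1).trans (le_of_eq ?_))
    simp only [D]
    ring
  have hsum : |∫ z, (J z * truncKernel δ g z + J (-z) * truncKernel δ g z -
      Q z * truncKernel δ g z)| ≤ D * δ * (4 * σ) := by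
    rw [← integral_norm_sq_mul_truncKernel hg, ← integral_const_mul, ← Real.norm_eq_abs]
    refine norm_integral_le_of_norm_le ((integrable_pow_mul_truncKernel hg 2).const_mul _)
      (Filter.Eventually.of_forall fun z => ?_)
    rw [← add_mul, ← sub_mul, norm_mul, Real.norm_of_nonneg (truncKernel_nonneg hg z), ← mul_assoc]
    -- On the support one factor `‖z‖` is traded for `δ`, leaving the second moment.
    rcases lt_or_ge ‖z‖ δ with hz | hz
    · refine mul_le_mul_of_nonneg_right ((hpt z).trans ?_) (truncKernel_nonneg hg z)
      calc D * ‖z‖ ^ 3 = D * ‖z‖ * ‖z‖ ^ 2 := by ring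
        _ ≤ D * δ * ‖z‖ ^ 2 := by gcongr
    · simp [truncKernel_of_le hz]
  have e1 := integral_add hJi hJi'
  have e2 := integral_sub (hJi.add hJi') hQi
  simp only [Pi.add_apply] at e2
  rw [e2, e1, hJ', hQ] at hsum
  rw [hJ]
  have h5 : ∀ a b : ℝ, |a + a - 2 * σ * b| = 2 * |a - σ * b| := by
    intro a b
    rw [← abs_two, ← abs_mul, abs_two]; congr 1; ring
  rw [h5] at hsum
  linarith

/-! ### Cutting off and expanding the functions -/

theorem exists_contDiff_extension {S : Set Plane} (hS : Bornology.IsBounded S) {r : ℝ}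
    (hr : 0 < r) {n : ℕ} {u : Plane → ℝ} (hu : ContDiffOn ℝ n u (Metric.thickening r S)) :
    ∃ w : Plane → ℝ, ContDiff ℝ n w ∧ HasCompactSupport w ∧
      EqOn w u (Metric.thickening (r / 2) S) := by
  -- The intermediate radius `3r/4` keeps the closed support of the cutoff inside the region where
  -- `u` is regular.
  obtain ⟨χ, hχ, -, hsupp, hone⟩ := exists_contMDiff_support_eq_eq_one_iff
    (modelWithCornersSelf ℝ Plane) (n := n) (Metric.isOpen_thickening (δ := 3 * r / 4) (E := S))
    (Metric.isClosed_cthickening (δ := r / 2) (E := S))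
    (Metric.cthickening_subset_thickening' (by linarith) (by linarith) S)
  rw [contMDiff_iff_contDiff] at hχ
  have hts : tsupport χ ⊆ Metric.cthickening (3 * r / 4) S := by
    rw [tsupport, hsupp]
    exact Metric.closure_thickening_subset_cthickening _ _
  have hts' : tsupport χ ⊆ Metric.thickening r S :=
    hts.trans (Metric.cthickening_subset_thickening' hr (by linarith) S)
  have hχc : HasCompactSupport χ :=
    HasCompactSupport.of_support_subset_isCompact
      (Metric.isCompact_of_isClosed_isBounded Metric.isClosed_cthickening hS.cthickening)
      (subset_closure.trans hts)
  refine ⟨fun x => χ x * u x, contDiff_iff_contDiffAt.2 fun x => ?_, hχc.mul_right, fun x hx => ?_⟩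
  · by_cases hx : x ∈ tsupport χ
    · exact hχ.contDiffAt.mul (hu.contDiffAt (Metric.isOpen_thickening.mem_nhds (hts' hx)))
    · refine (contDiffAt_const (c := (0 : ℝ))).congr_of_eventuallyEq ?_
      filter_upwards [notMem_tsupport_iff_eventuallyEq.1 hx] with y hy
      simp [hy]
  · have h1 : χ x = 1 := (hone x).1 (Metric.thickening_subset_cthickening _ _ hx)
    simp [h1]

theorem exists_abs_sub_sub_fderiv_le {u : Plane → ℝ} (hu : ContDiff ℝ 2 u)
    (hc : HasCompactSupport u) :
    ∃ M : ℝ, 0 ≤ M ∧ ∀ x z, |u (x + z) - u x - fderiv ℝ u x z| ≤ M * ‖z‖ ^ 2 := by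
  have h1 : ContDiff ℝ 1 (fderiv ℝ u) := hu.fderiv_right (by norm_num)
  obtain ⟨M, hM⟩ := h1.lipschitzWith_of_hasCompactSupport (hc.fderiv ℝ) one_ne_zero
  refine ⟨M, M.coe_nonneg, fun x z => ?_⟩
  have h2 := (convex_closedBall x ‖z‖).norm_image_sub_le_of_norm_fderiv_le' (f := u)
    (φ := fderiv ℝ u x) (C := M * ‖z‖) (x := x) (y := x + z)
    (fun y _ => hu.differentiable (by norm_num) y)
    (fun y hy => (hM.norm_sub_le y x).trans (by
      rw [mem_closedBall_iff_norm] at hy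
      gcongr))
    (Metric.mem_closedBall_self (norm_nonneg z)) (by simp)
  rw [add_sub_cancel_left, Real.norm_eq_abs] at h2
  calc _ ≤ _ := h2
    _ = _ := by ring

theorem exists_abs_le_of_hasCompactSupport {u : Plane → ℝ} (hc : HasCompactSupport u)
    (hu : Continuous u) : ∃ a : ℝ, 0 ≤ a ∧ ∀ x, |u x| ≤ a := by
  obtain ⟨a, ha⟩ := hc.exists_bound_of_continuous hu
  exact ⟨a, (norm_nonneg _).trans (ha 0), ha⟩

/-- Both pairings across the boundary, with the test function taken on either side of it, converge
to the boundary pairing. -/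
theorem exists_abs_crossing_sub_boundary_le {Ω : Set Plane} (hΩ : IsOpen Ω) (hc : Convex ℝ Ω)
    (hb : Bornology.IsBounded Ω) {Γ : ℝ → Plane} {L : ℝ}
    (hΓ : IsClosedC2Curve Γ L (frontier Ω)) {p : Plane} (hp : p ∈ Ω) {u v : Plane → ℝ}
    (hu : ContDiff ℝ 2 u) (huc : HasCompactSupport u) (hv : ContDiff ℝ 1 v)
    (hvc : HasCompactSupport v) :
    ∃ C : ℝ, ∀ δ σ : ℝ, ∀ g : ℝ → ℝ, IsKernel δ σ g →
      |(∫ q in Ω ×ˢ Ωᶜ, (u q.2 - u q.1) * v q.1 * truncKernel δ g (q.2 - q.1)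
          ∂(volume.prod volume)) -
        σ * ∫ η in (0 : ℝ)..L, v (Γ η) * fderiv ℝ u (Γ η) (outwardNormal Ω Γ η) * ‖deriv Γ η‖|
        ≤ C * σ * δ ∧
      |(∫ q in Ω ×ˢ Ωᶜ, (u q.2 - u q.1) * v q.2 * truncKernel δ g (q.2 - q.1)
          ∂(volume.prod volume)) -
        σ * ∫ η in (0 : ℝ)..L, v (Γ η) * fderiv ℝ u (Γ η) (outwardNormal Ω Γ η) * ‖deriv Γ η‖|
        ≤ C * σ * δ := by
  obtain ⟨M, hM0, hM⟩ := exists_abs_sub_sub_fderiv_le hu huc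
  obtain ⟨a, ha0, ha⟩ := exists_abs_le_of_hasCompactSupport huc hu.continuous
  obtain ⟨b, hb0, hvb⟩ := exists_abs_le_of_hasCompactSupport hvc hv.continuous
  obtain ⟨Ku, hKu⟩ := hu.lipschitzWith_of_hasCompactSupport huc two_ne_zero
  obtain ⟨Kv, hKv⟩ := hv.lipschitzWith_of_hasCompactSupport hvc one_ne_zero
  set Ψ : Plane → Plane →L[ℝ] ℝ := fun x => v x • fderiv ℝ u x
  have hΨ : ContDiff ℝ 1 Ψ := hv.smul (hu.fderiv_right (by norm_num))
  have hΨc : HasCompactSupport Ψ := hvc.smul_right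
  have huC := hu.continuous
  have hvC := hv.continuous
  have hjump : ∀ x y, |u x - u y| ≤ a + a := fun x y =>
    (abs_sub _ _).trans (add_le_add (ha _) (ha _))
  have h1 : ∀ x z, |(u (x + z) - u x) * v x - Ψ x z| ≤ b * M * ‖z‖ ^ 2 := by
    intro x z
    have : (u (x + z) - u x) * v x - Ψ x z = v x * (u (x + z) - u x - fderiv ℝ u x z) := by
      simp only [Ψ, smul_apply, smul_eq_mul]; ring
    rw [this, abs_mul, mul_assoc]
    exact mul_le_mul (hvb x) (hM x z) (abs_nonneg _) hb0
  -- Moving the test function across the boundary costs a product of two Lipschitz increments, which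
  -- is quadratic; hence the same `Ψ` serves both sides.
  have h2 : ∀ x z, |(u (x + z) - u x) * v (x + z) - Ψ x z| ≤ (b * M + Ku * Kv) * ‖z‖ ^ 2 := by
    intro x z
    have h3 : |u (x + z) - u x| ≤ Ku * ‖z‖ := by simpa using hKu.norm_sub_le (x + z) x
    have h4 : |v (x + z) - v x| ≤ Kv * ‖z‖ := by simpa using hKv.norm_sub_le (x + z) x
    have h5 : (u (x + z) - u x) * v (x + z) - Ψ x z =
      ((u (x + z) - u x) * v x - Ψ x z) + (u (x + z) - u x) * (v (x + z) - v x) := by ring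
    rw [h5]
    refine (abs_add_le _ _).trans ?_
    rw [abs_mul]
    calc _ ≤ b * M * ‖z‖ ^ 2 + (Ku * ‖z‖) * (Kv * ‖z‖) := by
          gcongr
          exact h1 x z
      _ = _ := by ring
  obtain ⟨C₁, hC₁⟩ := exists_abs_setIntegral_sub_boundary_le hΩ hc hb hΓ hp hΨ hΨc
    (k := fun q => (u q.2 - u q.1) * v q.1) (by fun_prop) (c := (a + a) * b)
    (fun q => by rw [abs_mul]; exact mul_le_mul (hjump _ _) (hvb _) (abs_nonneg _) (by linarith))
    (by positivity) h1
  obtain ⟨C₂, hC₂⟩ := exists_abs_setIntegral_sub_boundary_le hΩ hc hb hΓ hp hΨ hΨc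
    (k := fun q => (u q.2 - u q.1) * v q.2) (by fun_prop) (c := (a + a) * b)
    (fun q => by rw [abs_mul]; exact mul_le_mul (hjump _ _) (hvb _) (abs_nonneg _) (by linarith))
    (by positivity) h2
  simp only [Ψ, smul_apply, smul_eq_mul] at hC₁ hC₂
  refine ⟨max C₁ C₂, fun δ σ g hg => ?_⟩
  have hδ : 0 ≤ δ := hg.horizon_pos.le
  have hσ : 0 ≤ σ := by
    have : 0 ≤ ∫ z : Plane, ‖z‖ ^ 2 * truncKernel δ g z :=
      integral_nonneg fun z => mul_nonneg (sq_nonneg _) (truncKernel_nonneg hg z)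
    rw [integral_norm_sq_mul_truncKernel hg] at this
    linarith
  exact ⟨(hC₁ δ σ g hg).trans (by gcongr; exact le_max_left _ _),
    (hC₂ δ σ g hg).trans (by gcongr; exact le_max_right _ _)⟩

theorem continuous_clm_outwardNormal_mul {Ω : Set Plane} (hΩ : IsOpen Ω) (hc : Convex ℝ Ω)
    {Γ : ℝ → Plane} {L : ℝ} (hΓ : IsClosedC2Curve Γ L (frontier Ω)) {p : Plane} (hp : p ∈ Ω)
    {Φ : ℝ → Plane →L[ℝ] ℝ} (hΦ : Continuous Φ) :
    Continuous fun η => Φ η (outwardNormal Ω Γ η) * ‖deriv Γ η‖ := by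
  have hn : ∀ i, Continuous fun η => outwardNormal Ω Γ η i * ‖deriv Γ η‖ := by
    intro i
    have := continuous_inner_outwardNormal_mul hΩ hc hΓ hp (EuclideanSpace.single i (1 : ℝ))
    simpa [EuclideanSpace.inner_single_left] using this
  have he : (fun η => Φ η (outwardNormal Ω Γ η) * ‖deriv Γ η‖) = fun η =>
      Φ η (EuclideanSpace.single 0 1) * (outwardNormal Ω Γ η 0 * ‖deriv Γ η‖) +
      Φ η (EuclideanSpace.single 1 1) * (outwardNormal Ω Γ η 1 * ‖deriv Γ η‖) := by
    ext η
    rw [continuousLinearMap_plane (Φ η)]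
    ring
  rw [he]
  exact ((hΦ.clm_apply continuous_const).mul (hn 0)).add
    ((hΦ.clm_apply continuous_const).mul (hn 1))

/-! ### The nonlocal operators as integrals of the cut-off functions -/

/-- `IsKernel` does not force `g δ = 0`, so the two integrands may differ on the sphere of radius
`δ`, a null set. -/
theorem ae_jump_eq {δ σ : ℝ} {g : ℝ → ℝ} (hg : IsKernel δ σ g) {u w : Plane → ℝ} {x : Plane}
    {S : Set Plane} (hx : w x = u x) (hS : ∀ y ∈ S, dist x y < δ → w y = u y) :
    ∀ᵐ y : Plane, y ∈ S → jump g u x y = (w x - w y) * truncKernel δ g (y - x) := by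
  have h0 : ∀ᵐ y : Plane, y ∉ Metric.sphere x δ :=
    measure_eq_zero_iff_ae_notMem.1 (Measure.addHaar_sphere_of_ne_zero volume x hg.horizon_pos.ne')
  filter_upwards [h0] with y hy hyS
  rw [mem_sphere_iff_norm] at hy
  rw [jump, norm_sub_rev x y]
  rcases lt_or_gt_of_ne hy with h | h
  · rw [truncKernel_of_lt h, hx, hS y hyS (by rwa [dist_comm, dist_eq_norm])]
  · rw [truncKernel_of_le h.le, hg.eq_zero_of_lt _ h, mul_zero, mul_zero]

theorem integrable_sub_mul_truncKernel {δ σ : ℝ} {g : ℝ → ℝ} (hg : IsKernel δ σ g)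
    {w : Plane → ℝ} (hw : Continuous w) {a : ℝ} (ha : ∀ x, |w x| ≤ a) (x : Plane) :
    Integrable fun y => (w x - w y) * truncKernel δ g (y - x) := by
  refine Integrable.bdd_mul (c := a + a) ((integrable_truncKernel hg).comp_sub_right x)
    (by fun_prop) (Filter.Eventually.of_forall fun y => ?_)
  exact (abs_sub _ _).trans (add_le_add (ha _) (ha _))

theorem ae_notMem_frontier {Ω : Set Plane} (hc : Convex ℝ Ω) : ∀ᵐ y : Plane, y ∉ frontier Ω :=
  measure_eq_zero_iff_ae_notMem.1 (hc.addHaar_frontier volume)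

theorem innerLayer_subset_thickening {Ω : Set Plane} (hΩ : IsOpen Ω) {δ r : ℝ} (hδ : 0 < δ)
    (hr : δ ≤ r) : innerLayer Ω δ ⊆ Metric.thickening r (frontier Ω) := fun _ hx =>
  Metric.thickening_mono hr _ (fullLayer_eq_thickening hΩ hδ ▸ Or.inl (Or.inl hx))

theorem outerLayer_subset_thickening {Ω : Set Plane} (hΩ : IsOpen Ω) {δ r : ℝ} (hδ : 0 < δ)
    (hr : δ ≤ r) : outerLayer Ω δ ⊆ Metric.thickening r (frontier Ω) := fun _ hx =>
  Metric.thickening_mono hr _ (fullLayer_eq_thickening hΩ hδ ▸ Or.inr hx)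

section Operators

variable {Ω : Set Plane} {δ σ : ℝ} {g : ℝ → ℝ} {u w : Plane → ℝ} {x : Plane}

/-- The domain may grow from the outer layer to `Ωᶜ`: the added points are out of the kernel's reach
or on `∂Ω`, which is null since `Ω` is convex. -/
theorem neumannInner_eq_setIntegral (hΩ : IsOpen Ω) (hc : Convex ℝ Ω) (hg : IsKernel δ σ g)
    {r : ℝ} (hr : δ ≤ r) (hwu : EqOn w u (Metric.thickening r (frontier Ω)))
    (hw : Continuous w) {a : ℝ} (ha : ∀ x, |w x| ≤ a) (hx : x ∈ innerLayer Ω δ) :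
    IntegrableOn (jump g u x) (outerLayer Ω δ) ∧
    neumannInner Ω δ g u x = ∫ y in Ωᶜ, (w y - w x) * truncKernel δ g (y - x) := by
  have hδ := hg.horizon_pos
  have hae := ae_jump_eq hg (S := outerLayer Ω δ)
    (hwu (innerLayer_subset_thickening hΩ hδ hr hx))
    (fun y hy _ => hwu (outerLayer_subset_thickening hΩ hδ hr hy))
  have hm := measurableSet_outerLayer Ω δ
  refine ⟨(integrable_sub_mul_truncKernel hg hw ha x).integrableOn.congr
    ((ae_restrict_iff' hm).2 (hae.mono fun y h hy => (h hy).symm)), ?_⟩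
  rw [neumannInner, setIntegral_congr_ae hm hae, ← integral_neg]
  have h1 := setIntegral_eq_of_subset_of_ae_sdiff_eq_zero (μ := volume)
    (f := fun y => (w y - w x) * truncKernel δ g (y - x)) (s := outerLayer Ω δ) (t := Ωᶜ)
    hΩ.measurableSet.compl.nullMeasurableSet
    (fun y hy h => (mem_outerLayer_iff.1 hy).1 (subset_closure h)) (by
      filter_upwards [ae_notMem_frontier hc] with y hy hyS
      rw [truncKernel_of_le, mul_zero]
      by_contra! hlt
      refine hyS.2 (mem_outerLayer_iff.2 ⟨fun h => hy ?_, x, hx.1, by rwa [dist_eq_norm]⟩)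
      rw [hΩ.frontier_eq]
      exact ⟨h, hyS.1⟩)
  rw [h1]
  refine integral_congr_ae (Filter.Eventually.of_forall fun y => ?_)
  ring

theorem neumannOuter_eq_setIntegral (hΩ : IsOpen Ω) (hg : IsKernel δ σ g)
    {r : ℝ} (hr : δ ≤ r) (hwu : EqOn w u (Metric.thickening r (frontier Ω)))
    (hw : Continuous w) {a : ℝ} (ha : ∀ x, |w x| ≤ a) (hx : x ∈ outerLayer Ω δ) :
    IntegrableOn (jump g u x) (innerLayer Ω δ) ∧
    neumannOuter Ω δ g u x = ∫ y in Ω, (w x - w y) * truncKernel δ g (y - x) := by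
  have hδ := hg.horizon_pos
  have hae := ae_jump_eq hg (S := innerLayer Ω δ)
    (hwu (outerLayer_subset_thickening hΩ hδ hr hx))
    (fun y hy _ => hwu (innerLayer_subset_thickening hΩ hδ hr hy))
  have hm := measurableSet_innerLayer hΩ δ
  refine ⟨(integrable_sub_mul_truncKernel hg hw ha x).integrableOn.congr
    ((ae_restrict_iff' hm).2 (hae.mono fun y h hy => (h hy).symm)), ?_⟩
  rw [neumannOuter, setIntegral_congr_ae hm hae]
  refine (setIntegral_eq_of_subset_of_ae_sdiff_eq_zero
    hΩ.measurableSet.nullMeasurableSet (fun y hy => hy.1)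
    (Filter.Eventually.of_forall fun y hyS => ?_)).symm
  rw [truncKernel_of_le, mul_zero]
  by_contra! hlt
  exact hyS.2 (mem_innerLayer_iff.2
    ⟨hyS.1, x, fun h => hx.2 (subset_closure h), by rwa [dist_eq_norm]⟩)

/-- Up to the null curve, `Ω⁺` is the disjoint union of `Ω` and the outer layer. The first part
reproduces `N⁺`, the second is the self-interaction of the layer. -/
theorem neumannStar_eq_add_setIntegral (hΩ : IsOpen Ω) (hc : Convex ℝ Ω) (hg : IsKernel δ σ g)
    {r : ℝ} (hr : δ ≤ r) (hwu : EqOn w u (Metric.thickening r (frontier Ω)))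
    (hw : Continuous w) {a : ℝ} (ha : ∀ x, |w x| ≤ a) (hx : x ∈ outerLayer Ω δ) :
    IntegrableOn (jump g u x) (outerDomain Ω δ) ∧
    neumannStar Ω δ g u x = (∫ y in Ω, (w x - w y) * truncKernel δ g (y - x)) +
      ∫ y in outerLayer Ω δ, (w x - w y) * truncKernel δ g (y - x) := by
  have hδ := hg.horizon_pos
  have hxr := outerLayer_subset_thickening hΩ hδ hr hx
  have hae := ae_jump_eq hg (S := outerDomain Ω δ) (w := w) (u := u) (hwu hxr) (by
    intro y hy hxy
    refine hwu ?_
    by_cases hy1 : y ∈ Ω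
    · exact innerLayer_subset_thickening hΩ hδ hr (mem_innerLayer_iff.2
        ⟨hy1, x, fun h => hx.2 (subset_closure h), by rwa [dist_comm]⟩)
    by_cases hy2 : y ∈ closure Ω
    · exact Metric.self_subset_thickening (hδ.trans_le hr) _ (by
        rw [hΩ.frontier_eq]; exact ⟨hy2, hy1⟩)
    · exact outerLayer_subset_thickening hΩ hδ hr ⟨hy, hy2⟩)
  have hm : MeasurableSet (outerDomain Ω δ) := by
    rw [outerDomain_eq_thickening]; exact Metric.isOpen_thickening.measurableSet
  have hi := integrable_sub_mul_truncKernel hg hw ha x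
  refine ⟨hi.integrableOn.congr
    ((ae_restrict_iff' hm).2 (hae.mono fun y h hy => (h hy).symm)), ?_⟩
  rw [neumannStar, setIntegral_congr_ae hm hae, ← setIntegral_union
    (disjoint_left.2 fun y hy h => h.2 (subset_closure hy)) (measurableSet_outerLayer Ω δ)
    hi.integrableOn hi.integrableOn]
  refine setIntegral_congr_set ?_
  filter_upwards [ae_notMem_frontier hc] with y hy
  rw [hΩ.frontier_eq] at hy
  refine propext ⟨fun h => ?_, fun h => ?_⟩
  · by_cases hyΩ : y ∈ Ω
    · exact Or.inl hyΩ
    · exact Or.inr ⟨h, fun hcl => hy ⟨hcl, hyΩ⟩⟩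
  · rcases h with h | h
    · change y ∈ outerDomain Ω δ
      rw [outerDomain_eq_thickening]
      exact Metric.self_subset_thickening hδ _ h
    · exact h.1

end Operators

/-! ### The pairings as double integrals -/

theorem setIntegral_prod_and_integrableOn {A B : Set Plane} {f : Plane × Plane → ℝ}
    (hf : IntegrableOn f (A ×ˢ B) (volume.prod volume)) :
    IntegrableOn (fun x => ∫ y in B, f (x, y)) A ∧ IntegrableOn (fun y => ∫ x in A, f (x, y)) B ∧
    ∫ q in A ×ˢ B, f q ∂(volume.prod volume) = ∫ y in B, ∫ x in A, f (x, y) := by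
  rw [IntegrableOn, ← Measure.prod_restrict] at hf
  refine ⟨hf.integral_prod_left, hf.integral_prod_right, ?_⟩
  rw [← Measure.prod_restrict, integral_prod_symm f hf]

section Pairings

variable {Ω : Set Plane} {δ σ : ℝ} {g : ℝ → ℝ} {u v w φ : Plane → ℝ}

theorem abs_sub_mul_le {a b : ℝ} (ha : ∀ x, |w x| ≤ a) (hb : ∀ x, |φ x| ≤ b) (x y t : Plane) :
    |(w x - w y) * φ t| ≤ (a + a) * b := by
  have h1 : |w x - w y| ≤ a + a := (abs_sub _ _).trans (add_le_add (ha _) (ha _))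
  rw [abs_mul]
  exact mul_le_mul h1 (hb _) (abs_nonneg _) ((abs_nonneg _).trans h1)

/-- Points of `Ω` off the inner layer see no point of `Ωᶜ` within the horizon, so extending the
outer integral to `Ω` adds nothing. -/
theorem inner_pairing (hΩ : IsOpen Ω) (hc : Convex ℝ Ω) (hbd : Bornology.IsBounded Ω)
    (hg : IsKernel δ σ g) {r : ℝ} (hr : δ ≤ r)
    (hwu : EqOn w u (Metric.thickening r (frontier Ω)))
    (hφv : EqOn φ v (Metric.thickening r (frontier Ω)))
    (hw : Continuous w) (hφ : Continuous φ) {a b : ℝ} (ha : ∀ x, |w x| ≤ a)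
    (hb : ∀ x, |φ x| ≤ b) :
    IntegrableOn (fun x => neumannInner Ω δ g u x * v x) (innerLayer Ω δ) ∧
    ∫ x in innerLayer Ω δ, neumannInner Ω δ g u x * v x =
      ∫ q in Ω ×ˢ Ωᶜ, (w q.2 - w q.1) * φ q.1 * truncKernel δ g (q.2 - q.1)
        ∂(volume.prod volume) := by
  have hf := integrableOn_prod_kernel (B := Ωᶜ) hΩ.measurableSet hbd.measure_lt_top.ne
    (k := fun q => (w q.2 - w q.1) * φ q.1) (by fun_prop)
    (fun q => abs_sub_mul_le ha hb q.2 q.1 q.1) (integrable_truncKernel hg)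
  obtain ⟨hi, -, -⟩ := setIntegral_prod_and_integrableOn hf
  have hm := measurableSet_innerLayer hΩ δ
  have heq : EqOn (fun x => ∫ y in Ωᶜ, (w y - w x) * φ x * truncKernel δ g (y - x))
      (fun x => neumannInner Ω δ g u x * v x) (innerLayer Ω δ) := by
    intro x hx
    simp only [(neumannInner_eq_setIntegral hΩ hc hg hr hwu hw ha hx).2,
      ← hφv (innerLayer_subset_thickening hΩ hg.horizon_pos hr hx), ← integral_mul_const]
    exact integral_congr_ae (Filter.Eventually.of_forall fun y => by ring)
  refine ⟨(hi.mono_set fun x hx => hx.1).congr_fun heq hm, ?_⟩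
  rw [setIntegral_prod _ hf, ← setIntegral_congr_fun hm heq]
  refine (setIntegral_eq_of_subset_of_ae_sdiff_eq_zero
    hΩ.measurableSet.nullMeasurableSet (fun x hx => hx.1)
    (Filter.Eventually.of_forall fun x hx => ?_)).symm
  refine setIntegral_eq_zero_of_forall_eq_zero fun y hy => ?_
  rw [truncKernel_of_le, mul_zero]
  by_contra! hlt
  exact hx.2 (mem_innerLayer_iff.2 ⟨hx.1, y, hy, by rwa [dist_comm, dist_eq_norm]⟩)

theorem outer_pairing (hΩ : IsOpen Ω) (hc : Convex ℝ Ω) (hbd : Bornology.IsBounded Ω)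
    (hg : IsKernel δ σ g) (hw : Continuous w) (hφ : Continuous φ) {a b : ℝ}
    (ha : ∀ x, |w x| ≤ a) (hb : ∀ x, |φ x| ≤ b) :
    IntegrableOn (fun x => (∫ y in Ω, (w x - w y) * truncKernel δ g (y - x)) * φ x)
      (outerLayer Ω δ) ∧
    ∫ x in outerLayer Ω δ, (∫ y in Ω, (w x - w y) * truncKernel δ g (y - x)) * φ x =
      ∫ q in Ω ×ˢ Ωᶜ, (w q.2 - w q.1) * φ q.2 * truncKernel δ g (q.2 - q.1)
        ∂(volume.prod volume) := by
  have hf := integrableOn_prod_kernel (B := Ωᶜ) hΩ.measurableSet hbd.measure_lt_top.ne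
    (k := fun q => (w q.2 - w q.1) * φ q.2) (by fun_prop)
    (fun q => abs_sub_mul_le ha hb q.2 q.1 q.2) (integrable_truncKernel hg)
  obtain ⟨-, hi, hint⟩ := setIntegral_prod_and_integrableOn hf
  have hsub : outerLayer Ω δ ⊆ Ωᶜ := fun x hx h => hx.2 (subset_closure h)
  have hsymm : ∀ x y : Plane, truncKernel δ g (y - x) = truncKernel δ g (x - y) := fun x y => by
    rw [← truncKernel_neg, neg_sub]
  have heq : (fun x => (∫ y in Ω, (w x - w y) * truncKernel δ g (y - x)) * φ x) =
      fun x => ∫ y in Ω, (w x - w y) * φ x * truncKernel δ g (x - y) := by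
    ext x
    rw [← integral_mul_const]
    exact integral_congr_ae (Filter.Eventually.of_forall fun y => by
      simp only [hsymm x y]; ring)
  rw [heq, hint]
  refine ⟨hi.mono_set hsub, ?_⟩
  refine (setIntegral_eq_of_subset_of_ae_sdiff_eq_zero
    hΩ.measurableSet.compl.nullMeasurableSet hsub ?_).symm
  filter_upwards [ae_notMem_frontier hc] with x hx hxS
  refine setIntegral_eq_zero_of_forall_eq_zero fun y hy => ?_
  rw [truncKernel_of_le, mul_zero]
  by_contra! hlt
  refine hxS.2 (mem_outerLayer_iff.2 ⟨fun h => hx ?_, y, hy, by rwa [dist_eq_norm]⟩)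
  rw [hΩ.frontier_eq]
  exact ⟨h, hxS.1⟩

theorem outerLayer_measure_ne_top (hbd : Bornology.IsBounded Ω) (δ : ℝ) :
    volume (outerLayer Ω δ) ≠ ⊤ := by
  refine ((Bornology.IsBounded.subset (t := Metric.thickening δ Ω) hbd.thickening ?_)
    |>.measure_lt_top).ne
  rw [outerLayer, outerDomain_eq_thickening]
  exact fun x hx => hx.1

theorem layer_pairing (hbd : Bornology.IsBounded Ω)
    (hg : IsKernel δ σ g) (hw : Continuous w) (hφ : Continuous φ) {a b : ℝ}
    (ha : ∀ x, |w x| ≤ a) (hb : ∀ x, |φ x| ≤ b) :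
    IntegrableOn (fun x => (∫ y in outerLayer Ω δ, (w x - w y) * truncKernel δ g (y - x)) * φ x)
      (outerLayer Ω δ) ∧
    ∫ x in outerLayer Ω δ, (∫ y in outerLayer Ω δ, (w x - w y) * truncKernel δ g (y - x)) * φ x =
      ∫ q in outerLayer Ω δ ×ˢ outerLayer Ω δ,
        (w q.1 - w q.2) * φ q.1 * truncKernel δ g (q.2 - q.1) ∂(volume.prod volume) := by
  have hf := integrableOn_prod_kernel (B := outerLayer Ω δ) (measurableSet_outerLayer Ω δ)
    (outerLayer_measure_ne_top hbd δ) (k := fun q => (w q.1 - w q.2) * φ q.1) (by fun_prop)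
    (fun q => abs_sub_mul_le ha hb q.1 q.2 q.1) (integrable_truncKernel hg)
  obtain ⟨hi, -, -⟩ := setIntegral_prod_and_integrableOn hf
  have heq : (fun x => (∫ y in outerLayer Ω δ, (w x - w y) * truncKernel δ g (y - x)) * φ x) =
      fun x => ∫ y in outerLayer Ω δ, (w x - w y) * φ x * truncKernel δ g (y - x) := by
    ext x
    rw [← integral_mul_const]
    exact integral_congr_ae (Filter.Eventually.of_forall fun y => by ring)
  rw [heq, setIntegral_prod _ hf]
  exact ⟨hi, rfl⟩

end Pairings

end NonlocalNeumann

end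

/-! ### Assembly of the three estimates -/

open NonlocalNeumann

theorem theorem2p2
    (Ω : Set NonlocalNeumann.Plane) (hopen : IsOpen Ω) (hconv : Convex ℝ Ω)
    (hbdd : Bornology.IsBounded Ω)
    (Γ : ℝ → NonlocalNeumann.Plane) (L : ℝ)
    (hΓ : NonlocalNeumann.IsClosedC2Curve Γ L (frontier Ω))
    (σ δ₀ : ℝ) (hδ₀ : 0 < δ₀) (u v : NonlocalNeumann.Plane → ℝ)
    (hu : ContDiffOn ℝ 2 u (NonlocalNeumann.fullLayer Ω δ₀))
    (hv : ContDiffOn ℝ 1 v (NonlocalNeumann.fullLayer Ω δ₀)) :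
    IntervalIntegrable (NonlocalNeumann.boundaryDensity Ω Γ σ u v) MeasureTheory.volume 0 L ∧
    ∃ C δ₁ : ℝ, 0 < δ₁ ∧ ∀ δ : ℝ, 0 < δ → δ < δ₁ →
      ∀ g : ℝ → ℝ, NonlocalNeumann.IsKernel δ σ g →
        -- the inner operator, tested on the inner layer
        (NonlocalNeumann.BoundedOnLayer (NonlocalNeumann.neumannInner Ω δ g u)
            (NonlocalNeumann.innerLayer Ω δ) →
          (∀ x ∈ NonlocalNeumann.innerLayer Ω δ,
            MeasureTheory.IntegrableOn (NonlocalNeumann.jump g u x)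
              (NonlocalNeumann.outerLayer Ω δ)) ∧
          MeasureTheory.IntegrableOn (fun x => NonlocalNeumann.neumannInner Ω δ g u x * v x)
            (NonlocalNeumann.innerLayer Ω δ) ∧
          |(∫ x in NonlocalNeumann.innerLayer Ω δ, NonlocalNeumann.neumannInner Ω δ g u x * v x)
            - NonlocalNeumann.boundaryPairing Ω Γ L σ u v| ≤ C * δ) ∧
        -- the first outer operator, tested on the outer layer
        (NonlocalNeumann.BoundedOnLayer (NonlocalNeumann.neumannOuter Ω δ g u)
            (NonlocalNeumann.outerLayer Ω δ) →
          (∀ x ∈ NonlocalNeumann.outerLayer Ω δ,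
            MeasureTheory.IntegrableOn (NonlocalNeumann.jump g u x)
              (NonlocalNeumann.innerLayer Ω δ)) ∧
          MeasureTheory.IntegrableOn (fun x => NonlocalNeumann.neumannOuter Ω δ g u x * v x)
            (NonlocalNeumann.outerLayer Ω δ) ∧
          |(∫ x in NonlocalNeumann.outerLayer Ω δ, NonlocalNeumann.neumannOuter Ω δ g u x * v x)
            - NonlocalNeumann.boundaryPairing Ω Γ L σ u v| ≤ C * δ) ∧
        -- the second outer operator, tested on the outer layer
        (NonlocalNeumann.BoundedOnLayer (NonlocalNeumann.neumannStar Ω δ g u)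
            (NonlocalNeumann.outerLayer Ω δ) →
          (∀ x ∈ NonlocalNeumann.outerLayer Ω δ,
            MeasureTheory.IntegrableOn (NonlocalNeumann.jump g u x)
              (NonlocalNeumann.outerDomain Ω δ)) ∧
          MeasureTheory.IntegrableOn (fun x => NonlocalNeumann.neumannStar Ω δ g u x * v x)
            (NonlocalNeumann.outerLayer Ω δ) ∧
          |(∫ x in NonlocalNeumann.outerLayer Ω δ, NonlocalNeumann.neumannStar Ω δ g u x * v x)
            - NonlocalNeumann.boundaryPairing Ω Γ L σ u v| ≤ C * δ) := by
  -- An empty domain has empty frontier, which cannot be the range of a curve.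
  obtain ⟨p, hp⟩ : Ω.Nonempty := by
    rw [Set.nonempty_iff_ne_empty]
    rintro rfl
    have := hΓ.range_eq
    simp [Set.range_eq_empty_iff] at this
  rw [fullLayer_eq_thickening hopen hδ₀] at hu hv
  have hSb : Bornology.IsBounded (frontier Ω) := hbdd.closure.subset frontier_subset_closure
  obtain ⟨w, hw, hwc, hwu⟩ := exists_contDiff_extension hSb hδ₀ (n := 2) hu
  obtain ⟨φ, hφ, hφc, hφv⟩ := exists_contDiff_extension hSb hδ₀ (n := 1) (by exact_mod_cast hv)
  replace hw : ContDiff ℝ 2 w := hw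
  replace hφ : ContDiff ℝ 1 φ := by exact_mod_cast hφ
  obtain ⟨a, -, ha⟩ := exists_abs_le_of_hasCompactSupport hwc hw.continuous
  obtain ⟨b, -, hb⟩ := exists_abs_le_of_hasCompactSupport hφc hφ.continuous
  obtain ⟨C, hC⟩ := exists_abs_crossing_sub_boundary_le hopen hconv hbdd hΓ hp hw hwc hφ hφc
  obtain ⟨Kw, hKw⟩ := hw.lipschitzWith_of_hasCompactSupport hwc two_ne_zero
  obtain ⟨Kφ, hKφ⟩ := hφ.lipschitzWith_of_hasCompactSupport hφc one_ne_zero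
  obtain ⟨E, ρ, hE, hρ, hEle⟩ := exists_measureReal_outerLayer_le hopen hconv hbdd
  have hprod : ∀ x y, |(w x - w y) * (φ x - φ y)| ≤ ((Kw : ℝ) * Kφ) * ‖x - y‖ ^ 2 := by
    intro x y
    rw [abs_mul]
    calc _ ≤ ((Kw : ℝ) * ‖x - y‖) * (Kφ * ‖x - y‖) :=
          mul_le_mul (hKw.norm_sub_le x y) (hKφ.norm_sub_le x y) (abs_nonneg _) (by positivity)
      _ = _ := by ring
  have hdens : boundaryDensity Ω Γ σ u v = fun η =>
      σ * (φ (Γ η) * fderiv ℝ w (Γ η) (outwardNormal Ω Γ η) * ‖deriv Γ η‖) := by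
    ext η
    have hη : Γ η ∈ Metric.thickening (δ₀ / 2) (frontier Ω) :=
      Metric.self_subset_thickening (half_pos hδ₀) _ (hΓ.range_eq ▸ mem_range_self η)
    have hd : fderiv ℝ w (Γ η) = fderiv ℝ u (Γ η) :=
      (hwu.eventuallyEq_of_mem (Metric.isOpen_thickening.mem_nhds hη)).fderiv_eq
    rw [boundaryDensity, hd, hφv hη]
    ring
  have hpair : boundaryPairing Ω Γ L σ u v = σ * ∫ η in (0 : ℝ)..L,
      φ (Γ η) * fderiv ℝ w (Γ η) (outwardNormal Ω Γ η) * ‖deriv Γ η‖ := by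
    rw [boundaryPairing, hdens, intervalIntegral.integral_const_mul]
  -- The first summand bounds the crossing term, the second the self-interaction in `N*`; absolute
  -- values let one constant serve all three operators. Below `δ₀ / 2` the layers stay where `w = u`
  -- and `φ = v`, and below `ρ` the area bound holds.
  refine ⟨?_, |C * σ| + |2 * (Kw * Kφ) * σ * E|, min (δ₀ / 2) ρ, lt_min (half_pos hδ₀) hρ,
    fun δ hδ hδ₁ g hg => ?_⟩
  · rw [hdens]
    have hΓc : Continuous Γ := hΓ.contDiff.continuous
    have h1 := continuous_clm_outwardNormal_mul hopen hconv hΓ hp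
      (Φ := fun η => φ (Γ η) • fderiv ℝ w (Γ η))
      ((hφ.continuous.comp hΓc).smul ((hw.continuous_fderiv two_ne_zero).comp hΓc))
    exact (h1.const_mul σ).intervalIntegrable _ _
  have hr : δ ≤ δ₀ / 2 := (hδ₁.trans_le (min_le_left _ _)).le
  obtain ⟨hC₁, hC₂⟩ := hC δ σ g hg
  rw [← hpair] at hC₁ hC₂
  have hCle : C * σ * δ ≤ (|C * σ| + |2 * (Kw * Kφ) * σ * E|) * δ := by
    gcongr
    linarith [le_abs_self (C * σ), abs_nonneg (2 * (Kw * Kφ) * σ * E)]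
  obtain ⟨ho1, ho2⟩ := outer_pairing hopen hconv hbdd hg hw.continuous hφ.continuous ha hb
  have hm := measurableSet_outerLayer Ω δ
  have hv' : ∀ x ∈ outerLayer Ω δ, φ x = v x := fun x hx =>
    hφv (outerLayer_subset_thickening hopen hδ hr hx)
  refine ⟨fun _ => ?_, fun _ => ?_, fun _ => ?_⟩
  · obtain ⟨h1, h2⟩ := inner_pairing hopen hconv hbdd hg hr hwu hφv hw.continuous hφ.continuous
      ha hb
    refine ⟨fun x hx =>
      (neumannInner_eq_setIntegral hopen hconv hg hr hwu hw.continuous ha hx).1, h1, ?_⟩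
    rw [h2]
    exact hC₁.trans hCle
  · have hrep := fun x hx =>
      neumannOuter_eq_setIntegral hopen hg hr hwu hw.continuous ha (x := x) hx
    have heq : EqOn (fun x => (∫ y in Ω, (w x - w y) * truncKernel δ g (y - x)) * φ x)
        (fun x => neumannOuter Ω δ g u x * v x) (outerLayer Ω δ) := fun x hx => by
      simp only [(hrep x hx).2, hv' x hx]
    refine ⟨fun x hx => (hrep x hx).1, ho1.congr_fun heq hm, ?_⟩
    rw [← setIntegral_congr_fun hm heq, ho2]
    exact hC₂.trans hCle
  · have hrep := fun x hx =>
      neumannStar_eq_add_setIntegral hopen hconv hg hr hwu hw.continuous ha (x := x) hx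
    obtain ⟨hl1, hl2⟩ := layer_pairing (Ω := Ω) hbdd hg hw.continuous hφ.continuous ha hb
    have heq : EqOn (fun x => (∫ y in Ω, (w x - w y) * truncKernel δ g (y - x)) * φ x +
        (∫ y in outerLayer Ω δ, (w x - w y) * truncKernel δ g (y - x)) * φ x)
        (fun x => neumannStar Ω δ g u x * v x) (outerLayer Ω δ) := fun x hx => by
      simp only [(hrep x hx).2, hv' x hx, add_mul]
    refine ⟨fun x hx => (hrep x hx).1, (ho1.add hl1).congr_fun heq hm, ?_⟩
    rw [← setIntegral_congr_fun hm heq, integral_add ho1 hl1, ho2, hl2]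
    -- The self-interaction is bounded by the area of the layer, which supplies the factor `δ`.
    have hsq := abs_setIntegral_square_le hg hm (outerLayer_measure_ne_top hbdd δ) hw.continuous
      hφ.continuous ha hb (M := Kw * Kφ) (by positivity) hprod
    have hσ : 0 ≤ 2 * (Kw * Kφ) * σ := by
      have : 0 ≤ ∫ z : Plane, ‖z‖ ^ 2 * truncKernel δ g z :=
        integral_nonneg fun z => mul_nonneg (sq_nonneg _) (truncKernel_nonneg hg z)
      rw [integral_norm_sq_mul_truncKernel hg] at this
      have : 0 ≤ σ := by linarith
      positivity
    have hlay := mul_le_mul_of_nonneg_left (hEle δ hδ (hδ₁.trans_le (min_le_right _ _))) hσ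
    rw [add_sub_right_comm]
    refine (abs_add_le _ _).trans ((add_le_add hC₂ (hsq.trans hlay)).trans ?_)
    rw [add_mul]
    refine add_le_add (by gcongr; exact le_abs_self _) ?_
    rw [← mul_assoc]
    gcongr
    exact le_abs_self _
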